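/- Consider a $2\times 2$ input-queued switch in discrete time, with four queues: number the input/output pairs $(1,1),(1,2),(2,1),(2,2)$ as $1,2,3,4$. A service vector $s\in\{0,1\}^4$ is feasible if $s_1+s_2\le 1$, $s_3+s_4\le 1$, $s_1+s_3\le 1$ and $s_2+s_4\le 1$. In every time slot, if the queue lengths are $q\in\mathbb{Z}_+^4$, the MaxWeight policy selects a feasible $s$ maximizing $\langle q,s\rangle$ (ties are broken at random, according to any law that depends only on $q$); then a vector $a\in\mathbb{Z}_+^4$ of arrivals, independent of $(q,s)$, joins the queues, and the queue lengths become $q^+=q+a-s+u$, where $u_i=\max\{s_i-q_i-a_i,0\}$ is the unused service. The arrival vectors of different time slots are independent and identically distributed. Let $\nu\in(0,\infty)^4$ satisfy $\nu_1+\nu_2=\nu_3+\nu_4=\nu_1+\nu_3=\nu_2+\nu_4=1$ (complete saturation). Consider a family of such switches indexed by $\epsilon\in(0,1)$, in which the four coordinates of the arrival vector $\overline{a}^{(\epsilon)}$ are independent, are bounded by a constant $A_{\max}$ that does not depend on $\epsilon$, and have means $\mathbb{E}[\overline{a}^{(\epsilon)}_i]=(1-\epsilon)\nu_i$; suppose that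 $\lim_{\epsilon\downarrow 0}\mathrm{Var}(\overline{a}^{(\epsilon)}_i)=\sigma_{a_i}^2$ for $i=1,2,3,4$. Then for every $\epsilon\in(0,1)$ the Markov chain of queue lengths has a unique stationary distribution; if $\overline{q}^{(\epsilon)}$ has this distribution, then $\mathbb{E}[\overline{q}^{(\epsilon)}_2+\overline{q}^{(\epsilon)}_3]<\infty$, and $$\lim_{\epsilon\downarrow 0}\epsilon\,\mathbb{E}\left[\overline{q}^{(\epsilon)}_2+\overline{q}^{(\epsilon)}_3\right]=\frac{3}{8}\left(\sigma_{a_1}^2+\sigma_{a_2}^2+\sigma_{a_3}^2+\sigma_{a_4}^2\right).$$ -/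

import Mathlib

open Set Filter Topology MeasureTheory ProbabilityTheory

/-! The `2 × 2` input-queued switch in discrete time.  Vectors indexed by `Fin 4` list the four
input/output pairs row by row: `0 = (1,1)`, `1 = (1,2)`, `2 = (2,1)`, `3 = (2,2)`. -/

namespace InputQueuedSwitch

/-- Queue lengths, arrivals and services are vectors of four natural numbers. -/
abbrev Vec : Type := Fin 4 → ℕ

/-- The feasible service vectors: entries in `{0, 1}`, with at most one active queue in every row
(input port) and in every column (output port). -/
def Feasible (s : Vec) : Prop :=
  (∀ i, s i ≤ 1) ∧ s 0 + s 1 ≤ 1 ∧ s 2 + s 3 ≤ 1 ∧ s 0 + s 2 ≤ 1 ∧ s 1 + s 3 ≤ 1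

/-- `s` is a MaxWeight schedule in state `q`: `s ∈ argmax {⟨q, x⟩ : x feasible}`. -/
def IsMaxWeight (q s : Vec) : Prop :=
  Feasible s ∧ ∀ x, Feasible x → ∑ i, q i * x i ≤ ∑ i, q i * s i

/-- A MaxWeight scheduling policy: in state `q` the schedule is drawn at random among the maximal
weight schedules.  The tie-breaking law is arbitrary. -/
structure MaxWeightPolicy where
  /-- the law of the schedule selected in state `q` -/
  sched : Vec → PMF Vec
  isMaxWeight : ∀ q, ∀ s ∈ (sched q).support, IsMaxWeight q s

/-- Unused service: the part of the potential service `s` that exceeds the available packets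
(those in line and those arriving).  The subtraction is truncated. -/
def unused (q a s : Vec) : Vec := fun i => s i - (q i + a i)

/-- Queue lengths one time slot later, `q + a - s + u`. -/
def next (q a s : Vec) : Vec := fun i => q i + a i + unused q a s i - s i

/-- The subtraction in `next` is never truncated. -/
theorem next_cast (q a s : Vec) (i : Fin 4) :
    (next q a s i : ℤ) = q i + a i - s i + unused q a s i := by
  unfold next unused
  omega

/-- Service is unused only in queues that end up empty. -/
theorem next_mul_unused (q a s : Vec) (i : Fin 4) : next q a s i * unused q a s i = 0 := by
  unfold next unused
  rcases le_total (s i) (q i + a i) with h | h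
  · rw [Nat.sub_eq_zero_of_le h, mul_zero]
  · have : q i + a i + (s i - (q i + a i)) - s i = 0 := by omega
    rw [this, zero_mul]

/-- One time slot of the queue length chain, from state `q`: the schedule is selected by the
policy, and independently of it a vector of arrivals with law `A` comes in. -/
noncomputable def transition (A : PMF Vec) (p : MaxWeightPolicy) (q : Vec) : PMF Vec :=
  (p.sched q).bind fun s => A.map fun a => next q a s

/-- The law of the queue length vector after `k` time slots, when its initial law is `π₀`. -/
noncomputable def lawAt (A : PMF Vec) (p : MaxWeightPolicy) (π₀ : PMF Vec) : ℕ → PMF Vec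
  | 0 => π₀
  | k + 1 => (lawAt A p π₀ k).bind (transition A p)

/-- `π` is a steady-state law of the queue length chain. -/
def IsSteadyState (A : PMF Vec) (p : MaxWeightPolicy) (π : PMF Vec) : Prop :=
  π.bind (transition A p) = π

/-- Whenever the chain converges in distribution, the limit is a steady-state law. -/
theorem isSteadyState_of_tendsto (A : PMF Vec) (p : MaxWeightPolicy) (π₀ π : PMF Vec)
    (h : ∀ q, Tendsto (fun k => lawAt A p π₀ k q) atTop (𝓝 (π q))) : IsSteadyState A p π := by
  have hle : ∀ y, (π.bind (transition A p)) y ≤ π y := by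
    intro y
    rw [PMF.bind_apply, ENNReal.tsum_eq_iSup_sum]
    refine iSup_le fun F => ?_
    have h1 : Tendsto (fun k => ∑ x ∈ F, lawAt A p π₀ k x * transition A p x y) atTop
        (𝓝 (∑ x ∈ F, π x * transition A p x y)) :=
      tendsto_finsetSum _ fun x _ =>
        ENNReal.Tendsto.mul_const (h x) (Or.inr (PMF.apply_ne_top _ _))
    have h2 : Tendsto (fun k => lawAt A p π₀ (k + 1) y) atTop (𝓝 (π y)) :=
      (h y).comp (tendsto_add_atTop_nat 1)
    refine le_of_tendsto_of_tendsto' h1 h2 fun k => ?_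
    change _ ≤ ((lawAt A p π₀ k).bind (transition A p)) y
    rw [PMF.bind_apply]
    exact ENNReal.sum_le_tsum F
  unfold IsSteadyState
  ext y
  by_contra hne
  have hlt := lt_of_le_of_ne (hle y) hne
  have := ENNReal.tsum_lt_tsum (by rw [PMF.tsum_coe]; exact ENNReal.one_ne_top) hle hlt
  rw [PMF.tsum_coe, PMF.tsum_coe] at this
  exact lt_irrefl _ this

end InputQueuedSwitch

open InputQueuedSwitch

open scoped ENNReal NNReal

/-! ### Stationary laws of countable chains and Foster–Lyapunov bounds -/

section MarkovChains

variable {α : Type*}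

theorem PMF.tsum_bind_mul {β : Type*} (p : PMF α) (κ : α → PMF β) (f : β → ℝ≥0∞) :
    ∑' y, (p.bind κ) y * f y = ∑' x, p x * ∑' y, κ x y * f y := by
  simp only [PMF.bind_apply, ← ENNReal.tsum_mul_right, ← ENNReal.tsum_mul_left]
  rw [ENNReal.tsum_comm]
  simp only [mul_assoc]

theorem PMF.tsum_mul_le_of_forall_le (p : PMF α) {f : α → ℝ≥0∞} {c : ℝ≥0∞}
    (h : ∀ x ∈ p.support, f x ≤ c) : ∑' x, p x * f x ≤ c := by
  calc ∑' x, p x * f x ≤ ∑' x, p x * c := by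
        refine ENNReal.tsum_le_tsum fun x => ?_
        by_cases hx : p x = 0
        · simp [hx]
        · gcongr
          exact h x hx
    _ = c := by rw [ENNReal.tsum_mul_right, PMF.tsum_coe, one_mul]

theorem PMF.eq_of_le {p q : PMF α} (h : ∀ x, p x ≤ q x) : p = q := by
  ext y
  by_contra hne
  have := ENNReal.tsum_lt_tsum (by rw [PMF.tsum_coe]; exact ENNReal.one_ne_top) h
    (lt_of_le_of_ne (h y) hne)
  rw [PMF.tsum_coe, PMF.tsum_coe] at this
  exact lt_irrefl _ this

/-- A Foster–Lyapunov drift inequality bounds stationary moments. -/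
theorem tsum_mul_le_of_drift {κ : α → PMF α} {π : PMF α} (hπ : π.bind κ = π)
    {V f : α → ℝ≥0∞} {C : ℝ≥0∞} (hV : ∀ x, V x ≠ ⊤)
    (h : ∀ x, ∑' y, κ x y * V y + f x ≤ V x + C) :
    ∑' x, π x * f x ≤ C := by
  -- No moment of `V` under `π` is known to be finite, so `V` is capped at `M`. Below the cap the
  -- drift inequality survives; above it the capped function cannot increase, and `f` is dropped
  -- there. The finite capped moment then cancels.
  have key : ∀ M : ℕ, ∑' x, π x * (if V x ≤ M then f x else 0) ≤ C := by
    intro M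
    have hfin : ∑' x, π x * min (V x) M ≠ ⊤ := by
      refine ne_top_of_le_ne_top (ENNReal.natCast_ne_top M)
        (π.tsum_mul_le_of_forall_le fun x _ => min_le_right _ _)
    have hpt : ∀ x, ∑' y, κ x y * min (V y) M + (if V x ≤ M then f x else 0)
        ≤ min (V x) M + C := by
      intro x
      by_cases hx : V x ≤ M
      · rw [if_pos hx, min_eq_left hx]
        refine le_trans ?_ (h x)
        gcongr
        exact min_le_left _ _
      · rw [if_neg hx, add_zero, min_eq_right (not_le.1 hx).le]
        exact le_add_right ((κ x).tsum_mul_le_of_forall_le fun y _ => min_le_right _ _)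
    have hsum : ∑' x, π x * min (V x) M + ∑' x, π x * (if V x ≤ M then f x else 0)
        ≤ ∑' x, π x * min (V x) M + C := by
      calc _ = ∑' x, π x * (∑' y, κ x y * min (V y) M + (if V x ≤ M then f x else 0)) := by
            conv_lhs => enter [1]; rw [← hπ, PMF.tsum_bind_mul]
            rw [← ENNReal.tsum_add]
            simp only [mul_add]
        _ ≤ ∑' x, π x * (min (V x) M + C) :=
            ENNReal.tsum_le_tsum fun x => mul_le_mul_right (hpt x) _
        _ = _ := by
            simp only [mul_add]
            rw [ENNReal.tsum_add, ENNReal.tsum_mul_right (a := C), PMF.tsum_coe, one_mul]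
    exact (ENNReal.add_le_add_iff_left hfin).1 hsum
  rw [ENNReal.tsum_eq_iSup_sum]
  refine iSup_le fun F => ?_
  obtain ⟨M, hM⟩ : ∃ M : ℕ, ∀ x ∈ F, V x ≤ M := by
    choose n hn using fun x => ENNReal.exists_nat_gt (hV x)
    refine ⟨F.sup n, fun x hx => (hn x).le.trans ?_⟩
    exact_mod_cast Finset.le_sup (f := n) hx
  calc ∑ x ∈ F, π x * f x = ∑ x ∈ F, π x * (if V x ≤ M then f x else 0) :=
        Finset.sum_congr rfl fun x hx => by rw [if_pos (hM x hx)]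
    _ ≤ _ := ENNReal.sum_le_tsum F
    _ ≤ C := key M

/-- Two stationary laws agree as soon as every nonzero stationary measure charges a given point. -/
theorem stationary_unique {κ : α → PMF α} {x₀ : α}
    (hx₀ : ∀ m : α → ℝ≥0∞, (∀ y, ∑' x, m x * κ x y = m y) → m x₀ = 0 → ∀ x, m x = 0)
    {π π' : PMF α} (hπ : π.bind κ = π) (hπ' : π'.bind κ = π') : π = π' := by
  have hb : ∀ y, ∑' x, π x * κ x y = π y := fun y => by rw [← PMF.bind_apply, hπ]
  have hb' : ∀ y, ∑' x, π' x * κ x y = π' y := fun y => by rw [← PMF.bind_apply, hπ']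
  -- The minimum satisfies mκ ≤ m, and κ preserves the finite total mass, so m is invariant. Hence π
  -- - m and π' - m are invariant too, and one of them vanishes at `x₀`.
  set m : α → ℝ≥0∞ := fun x => min (π x) (π' x) with hm
  have hmtop : ∑' x, m x ≠ ⊤ := ne_top_of_le_ne_top ENNReal.one_ne_top
    ((ENNReal.tsum_le_tsum fun x => min_le_left _ _).trans_eq π.tsum_coe)
  have hle : ∀ y, ∑' x, m x * κ x y ≤ m y := fun y => le_min
    ((ENNReal.tsum_le_tsum fun x => by gcongr; exact min_le_left _ _).trans_eq (hb y))
    ((ENNReal.tsum_le_tsum fun x => by gcongr; exact min_le_right _ _).trans_eq (hb' y))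
  have hmass : ∑' y, ∑' x, m x * κ x y = ∑' x, m x := by
    rw [ENNReal.tsum_comm]
    simp only [ENNReal.tsum_mul_left, PMF.tsum_coe, mul_one]
  have hinv : ∀ y, ∑' x, m x * κ x y = m y := by
    intro y
    by_contra hne
    have := ENNReal.tsum_lt_tsum (by rwa [hmass]) hle (lt_of_le_of_ne (hle y) hne)
    rw [hmass] at this
    exact lt_irrefl _ this
  have hmx : ∀ x, m x ≠ ⊤ := fun x =>
    ne_top_of_le_ne_top (PMF.apply_ne_top π x) (min_le_left _ _)
  have hdiff : ∀ ρ : PMF α, (∀ y, ∑' x, ρ x * κ x y = ρ y) → (∀ x, m x ≤ ρ x) →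
      ∀ y, ∑' x, (ρ x - m x) * κ x y = ρ y - m y := by
    intro ρ hρ hmρ y
    have : ∑' x, (ρ x - m x) * κ x y + ∑' x, m x * κ x y = ρ y := by
      rw [← ENNReal.tsum_add, ← hρ y]
      refine tsum_congr fun x => ?_
      rw [← add_mul, tsub_add_cancel_of_le (hmρ x)]
    rw [hinv] at this
    exact (ENNReal.sub_eq_of_eq_add (hmx y) this.symm).symm
  rcases le_total (π x₀) (π' x₀) with h | h
  · have h0 := hx₀ _ (hdiff π hb fun x => min_le_left _ _) (by
      simp only [hm, min_eq_left h, tsub_self])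
    exact PMF.eq_of_le fun x => (tsub_eq_zero_iff_le.1 (h0 x)).trans (min_le_right _ _)
  · have h0 := hx₀ _ (hdiff π' hb' fun x => min_le_right _ _) (by
      simp only [hm, min_eq_right h, tsub_self])
    exact (PMF.eq_of_le fun x => (tsub_eq_zero_iff_le.1 (h0 x)).trans (min_le_left _ _)).symm

/-- A chain that satisfies a Foster–Lyapunov drift inequality whose drift rate has finite sublevel
sets has a stationary law. -/
theorem exists_stationary_of_drift {κ : α → PMF α} {V f : α → ℝ≥0∞} {C : ℝ≥0∞} (x₀ : α)
    (hV : V x₀ ≠ ⊤) (hC : C ≠ ⊤) (h : ∀ x, ∑' y, κ x y * V y + f x ≤ V x + C)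
    (hf : ∀ M : ℕ, {x | f x ≤ M}.Finite) : ∃ π : PMF α, π.bind κ = π := by
  let μ : ℕ → PMF α := fun n => Nat.rec (PMF.pure x₀) (fun _ p => p.bind κ) n
  have hμ : ∀ n, μ (n + 1) = (μ n).bind κ := fun n => rfl
  have hsum : ∀ n : ℕ, ∑' x, μ n x * V x + ∑ k ∈ Finset.range n, ∑' x, μ k x * f x
      ≤ V x₀ + n * C := by
    intro n
    induction n with
    | zero =>
      simp only [Finset.range_zero, Finset.sum_empty, add_zero, Nat.cast_zero, zero_mul]
      exact (μ 0).tsum_mul_le_of_forall_le fun x hx => by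
        have : x = x₀ := by simpa [μ] using hx
        rw [this]
    | succ n ih =>
      have hstep : ∑' x, μ (n + 1) x * V x + ∑' x, μ n x * f x ≤ ∑' x, μ n x * V x + C := by
        rw [hμ, PMF.tsum_bind_mul, ← ENNReal.tsum_add]
        calc _ = ∑' x, μ n x * (∑' y, κ x y * V y + f x) := by simp only [mul_add]
          _ ≤ ∑' x, μ n x * (V x + C) := ENNReal.tsum_le_tsum fun x => mul_le_mul_right (h x) _
          _ = _ := by
            simp only [mul_add]
            rw [ENNReal.tsum_add, ENNReal.tsum_mul_right (a := C), PMF.tsum_coe, one_mul]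
      rw [Finset.sum_range_succ]
      calc _ = (∑' x, μ (n + 1) x * V x + ∑' x, μ n x * f x)
            + ∑ k ∈ Finset.range n, ∑' x, μ k x * f x := by ring
        _ ≤ (∑' x, μ n x * V x + C) + ∑ k ∈ Finset.range n, ∑' x, μ k x * f x := by gcongr
        _ = (∑' x, μ n x * V x + ∑ k ∈ Finset.range n, ∑' x, μ k x * f x) + C := by ring
        _ ≤ (V x₀ + n * C) + C := by gcongr
        _ = _ := by push_cast; ring
  have hn0 : ∀ n : ℕ, ((n + 1 : ℕ) : ℝ≥0∞) ≠ 0 := fun n => by simp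
  have hnt : ∀ n : ℕ, ((n + 1 : ℕ) : ℝ≥0∞) ≠ ⊤ := fun n => ENNReal.natCast_ne_top _
  -- Cesàro averages of the laws started at `x₀`: the telescoped drift bounds their `f`-moment, and
  -- they are invariant up to an error 1/(n+1).
  let ρ : ℕ → α → ℝ≥0∞ := fun n x => ((n + 1 : ℕ) : ℝ≥0∞)⁻¹ * ∑ k ∈ Finset.range (n + 1), μ k x
  have hρ : ∀ n (g : α → ℝ≥0∞), ∑' x, ρ n x * g x
      = ((n + 1 : ℕ) : ℝ≥0∞)⁻¹ * ∑ k ∈ Finset.range (n + 1), ∑' x, μ k x * g x := by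
    intro n g
    simp only [ρ, mul_assoc, ENNReal.tsum_mul_left, Finset.sum_mul]
    rw [Summable.tsum_finsetSum fun _ _ => ENNReal.summable]
  have hρ1 : ∀ n, ∑' x, ρ n x = 1 := by
    intro n
    have := hρ n 1
    simp only [Pi.one_apply, mul_one, PMF.tsum_coe, Finset.sum_const, Finset.card_range,
      nsmul_eq_mul] at this
    rw [this, ENNReal.inv_mul_cancel (hn0 n) (hnt n)]
  have hρf : ∀ n, ∑' x, ρ n x * f x ≤ V x₀ + C := by
    intro n
    rw [hρ]
    calc _ ≤ ((n + 1 : ℕ) : ℝ≥0∞)⁻¹ * (V x₀ + (n + 1 : ℕ) * C) := by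
          gcongr
          exact le_trans (le_add_left le_rfl) (hsum (n + 1))
      _ = ((n + 1 : ℕ) : ℝ≥0∞)⁻¹ * V x₀ + C := by
          rw [mul_add, ← mul_assoc, ENNReal.inv_mul_cancel (hn0 n) (hnt n), one_mul]
      _ ≤ _ := by
          gcongr
          refine mul_le_of_le_one_left' ?_
          rw [ENNReal.inv_le_one]
          exact_mod_cast Nat.succ_pos n
  have hρκ : ∀ n y, ∑' x, ρ n x * κ x y ≤ ρ n y + ((n + 1 : ℕ) : ℝ≥0∞)⁻¹ := by
    intro n y
    rw [hρ]
    simp only [ρ, ← PMF.bind_apply, ← hμ]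
    calc _ ≤ ((n + 1 : ℕ) : ℝ≥0∞)⁻¹ * (∑ k ∈ Finset.range (n + 1), μ k y + μ (n + 1) y) := by
          rw [← Finset.sum_range_succ, Finset.sum_range_succ' (fun k => μ k y) (n + 1)]
          gcongr
          exact le_self_add
      _ ≤ _ := by
          rw [mul_add]
          gcongr
          exact mul_le_of_le_one_right' (PMF.coe_le_one _ _)
  -- By compactness of [0, ∞], an ultrafilter gives pointwise limits at all states at once, with no
  -- diagonal extraction.
  let U : Ultrafilter ℕ := hyperfilter ℕ
  let π : α → ℝ≥0∞ := fun x => (U.map fun n => ρ n x).lim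
  have hlim : ∀ x, Tendsto (fun n => ρ n x) U (𝓝 (π x)) := fun x =>
    (U.map fun n => ρ n x).le_nhds_lim
  have hinvlim : Tendsto (fun n : ℕ => ((n + 1 : ℕ) : ℝ≥0∞)⁻¹) U (𝓝 0) :=
    (ENNReal.tendsto_inv_nat_nhds_zero.comp (tendsto_add_atTop_nat 1)).mono_left
      (Nat.hyperfilter_le_atTop)
  have hmassle : ∑' x, π x ≤ 1 := by
    rw [ENNReal.tsum_eq_iSup_sum]
    refine iSup_le fun F => le_of_tendsto (tendsto_finsetSum F fun x _ => hlim x) ?_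
    exact Eventually.of_forall fun n => (ENNReal.sum_le_tsum F).trans_eq (hρ1 n)
  have hmassge : 1 ≤ ∑' x, π x := by
    -- Tightness: by Markov's inequality the mass outside the finite set {f ≤ M + 1} is at most (V
    -- x₀ + C)/(M + 1), so none escapes in the limit.
    have hM : ∀ M : ℕ, 1 ≤ ∑' x, π x + (V x₀ + C) * ((M + 1 : ℕ) : ℝ≥0∞)⁻¹ := by
      intro M
      let F := (hf (M + 1)).toFinset
      have h1 : ∀ n, 1 ≤ ∑ x ∈ F, ρ n x + (V x₀ + C) * ((M + 1 : ℕ) : ℝ≥0∞)⁻¹ := by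
        intro n
        calc 1 = ∑' x, ρ n x := (hρ1 n).symm
          _ ≤ ∑' x, ((F : Set α).indicator (ρ n) x
                + ρ n x * f x * ((M + 1 : ℕ) : ℝ≥0∞)⁻¹) := by
              refine ENNReal.tsum_le_tsum fun x => ?_
              by_cases hx : x ∈ (F : Set α)
              · rw [indicator_of_mem hx]
                exact le_self_add
              · rw [indicator_of_notMem hx, zero_add, mul_assoc]
                have hx' : ((M + 1 : ℕ) : ℝ≥0∞) ≤ f x := by
                  have : ¬ f x ≤ ((M + 1 : ℕ) : ℝ≥0∞) := by simpa [F] using hx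
                  exact (not_le.1 this).le
                refine le_mul_of_one_le_right' ?_
                calc 1 = ((M + 1 : ℕ) : ℝ≥0∞) * ((M + 1 : ℕ) : ℝ≥0∞)⁻¹ :=
                      (ENNReal.mul_inv_cancel (hn0 M) (hnt M)).symm
                  _ ≤ _ := by gcongr
          _ = ∑ x ∈ F, ρ n x + (∑' x, ρ n x * f x) * ((M + 1 : ℕ) : ℝ≥0∞)⁻¹ := by
              rw [ENNReal.tsum_add, ENNReal.tsum_mul_right]
              congr 1
              rw [tsum_eq_sum (s := F) fun x hx => indicator_of_notMem (by simpa using hx) _]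
              exact Finset.sum_congr rfl fun x hx => indicator_of_mem (by simpa using hx) _
          _ ≤ _ := by gcongr; exact hρf n
      refine (ge_of_tendsto ((tendsto_finsetSum F fun x _ => hlim x).add_const _)
        (Eventually.of_forall h1)).trans ?_
      gcongr
      exact ENNReal.sum_le_tsum F
    refine ge_of_tendsto (x := atTop) (f := fun M : ℕ =>
      ∑' x, π x + (V x₀ + C) * ((M + 1 : ℕ) : ℝ≥0∞)⁻¹) ?_ (Eventually.of_forall hM)
    have := ENNReal.Tendsto.const_mul (a := V x₀ + C)
      (ENNReal.tendsto_inv_nat_nhds_zero.comp (tendsto_add_atTop_nat 1))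
      (Or.inr (ENNReal.add_ne_top.2 ⟨hV, hC⟩))
    rw [mul_zero] at this
    simpa using this.const_add (∑' x, π x)
  have hmass : ∑' x, π x = 1 := le_antisymm hmassle hmassge
  let π' : PMF α := ⟨π, hmass ▸ ENNReal.summable.hasSum⟩
  refine ⟨π', PMF.eq_of_le fun y => ?_⟩
  rw [PMF.bind_apply, ENNReal.tsum_eq_iSup_sum]
  refine iSup_le fun F => ?_
  have h1 : Tendsto (fun n => ∑ x ∈ F, ρ n x * κ x y) U (𝓝 (∑ x ∈ F, π x * κ x y)) :=
    tendsto_finsetSum _ fun x _ =>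
      ENNReal.Tendsto.mul_const (hlim x) (Or.inr (PMF.apply_ne_top _ _))
  have h2 := (hlim y).add hinvlim
  rw [add_zero] at h2
  exact le_of_tendsto_of_tendsto' h1 h2 fun n => (ENNReal.sum_le_tsum F).trans (hρκ n y)

theorem PMF.lintegral_toMeasure [Countable α] [MeasurableSpace α] [MeasurableSingletonClass α]
    (p : PMF α) (f : α → ℝ≥0∞) : ∫⁻ x, f x ∂p.toMeasure = ∑' x, p x * f x := by
  rw [lintegral_countable']
  simp only [PMF.toMeasure_apply_singleton _ _ (measurableSet_singleton _), mul_comm]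

theorem PMF.ae_toMeasure [Countable α] [MeasurableSpace α] [MeasurableSingletonClass α]
    (p : PMF α) : ∀ᵐ x ∂p.toMeasure, x ∈ p.support := by
  rw [ae_iff, show {x | x ∉ p.support} = p.supportᶜ from rfl,
    PMF.toMeasure_apply_eq_zero_iff _ (to_countable _).measurableSet]
  exact disjoint_compl_right

end MarkovChains

/-! ### Full schedules and wasted service -/

namespace InputQueuedSwitch

/-- A full schedule (a permutation matrix) that dominates the feasible schedule `s`. -/
def fullSched (s : Vec) : Vec :=
  if s 0 + s 3 = 0 ∧ s 1 + s 2 ≠ 0 then ![0, 1, 1, 0] else ![1, 0, 0, 1]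

/-- The part of the full schedule dominating `s` that does not serve any packet. -/
def waste (q a s : Vec) (i : Fin 4) : ℝ := next q a s i - q i - a i + fullSched s i

theorem next_eq_add_waste (q a s : Vec) (i : Fin 4) :
    (next q a s i : ℝ) = q i + (a i - fullSched s i + waste q a s i) := by
  unfold waste; ring

theorem le_fullSched {s : Vec} (h : Feasible s) (i : Fin 4) : s i ≤ fullSched s i := by
  obtain ⟨h0, h1, h2, h3, h4⟩ := h
  have := h0 0
  have := h0 1
  have := h0 2
  have := h0 3
  unfold fullSched
  split_ifs with h
  · fin_cases i <;> simp <;> omega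
  · fin_cases i <;> simp <;> omega

theorem fullSched_cases (s : Vec) :
    fullSched s = ![1, 0, 0, 1] ∨ fullSched s = ![0, 1, 1, 0] := by
  unfold fullSched; split_ifs <;> simp

theorem feasible_fullSched (s : Vec) : Feasible (fullSched s) := by
  rcases fullSched_cases s with h | h <;> rw [h] <;> refine ⟨fun i => ?_, ?_⟩ <;>
    first | (fin_cases i <;> simp) | simp

/-- Completing a maximal weight schedule cannot raise its weight, so the termwise inequalities
between the two weights are equalities. -/
theorem IsMaxWeight.eq_zero_or {q s : Vec} (h : IsMaxWeight q s) (i : Fin 4) :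
    q i = 0 ∨ fullSched s i = s i := by
  have h1 := h.2 _ (feasible_fullSched s)
  have h2 : ∀ j ∈ Finset.univ, q j * s j ≤ q j * fullSched s j := fun j _ =>
    Nat.mul_le_mul_left _ (le_fullSched h.1 j)
  have h3 := (Finset.sum_eq_sum_iff_of_le h2).1 (le_antisymm (Finset.sum_le_sum h2) h1) i
    (Finset.mem_univ i)
  rcases Nat.eq_zero_or_pos (q i) with h0 | h0
  · exact Or.inl h0
  · exact Or.inr (Nat.eq_of_mul_eq_mul_left h0 h3).symm

theorem IsMaxWeight.fullSched_cases {q s : Vec} (h : IsMaxWeight q s) :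
    (fullSched s = ![1, 0, 0, 1] ∧ q 1 + q 2 ≤ q 0 + q 3) ∨
      (fullSched s = ![0, 1, 1, 0] ∧ q 0 + q 3 ≤ q 1 + q 2) := by
  have hw : ∀ x, Feasible x → ∑ i, q i * x i ≤ ∑ i, q i * fullSched s i := fun x hx =>
    (h.2 x hx).trans
      (Finset.sum_le_sum fun j _ => Nat.mul_le_mul_left _ (le_fullSched h.1 j))
  rcases InputQueuedSwitch.fullSched_cases s with hs | hs
  · have := hw ![0, 1, 1, 0] ⟨fun i => by fin_cases i <;> simp, by simp⟩
    rw [hs] at this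
    simp [Fin.sum_univ_four] at this
    exact Or.inl ⟨hs, this⟩
  · have := hw ![1, 0, 0, 1] ⟨fun i => by fin_cases i <;> simp, by simp⟩
    rw [hs] at this
    simp [Fin.sum_univ_four] at this
    exact Or.inr ⟨hs, this⟩

theorem fullSched_le_one (s : Vec) (i : Fin 4) : fullSched s i ≤ 1 := (feasible_fullSched s).1 i

/-- Waste also counts service that the completion adds at an empty queue, where arrivals may remain
afterwards. So, unlike for `unused`, the new queue need not be empty; it is only bounded by the
arrivals. -/
theorem IsMaxWeight.waste_cases {q s : Vec} (h : IsMaxWeight q s) (a : Vec) (i : Fin 4) :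
    waste q a s i = 0 ∨ (waste q a s i = 1 ∧ q i = 0 ∧ next q a s i ≤ a i) := by
  have h1 := fullSched_le_one s i
  have h2 := le_fullSched h.1 i
  have h3 := h.eq_zero_or i
  have key : (next q a s i + fullSched s i = q i + a i) ∨
      (next q a s i + fullSched s i = q i + a i + 1 ∧ q i = 0 ∧ next q a s i ≤ a i) := by
    simp only [next, unused]
    omega
  unfold waste
  rcases key with hk | ⟨hk, h4, h5⟩
  · left
    have : (next q a s i : ℝ) + fullSched s i = q i + a i := by exact_mod_cast hk
    linarith
  · right
    have : (next q a s i : ℝ) + fullSched s i = q i + a i + 1 := by exact_mod_cast hk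
    exact ⟨by linarith, h4, h5⟩

theorem tsum_transition_mul (A : PMF Vec) (p : MaxWeightPolicy) (q : Vec) (g : Vec → ℝ≥0∞) :
    ∑' y, transition A p q y * g y
      = ∑' s, p.sched q s * ∑' a, A a * g (next q a s) := by
  unfold transition
  rw [PMF.tsum_bind_mul]
  refine tsum_congr fun s => ?_
  rw [PMF.map, PMF.tsum_bind_mul]
  congr 1
  refine tsum_congr fun a => ?_
  congr 1
  rw [tsum_eq_single (next q a s)]
  · simp
  · intro y hy
    simp [hy]

/-! ### Drift of the square of a quadratic Lyapunov function -/

section Arrivals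

variable {A : PMF Vec} {Amax : ℕ}

theorem integrable_of_bounded_support {F : Vec → ℝ} {C : ℝ} (h : ∀ a ∈ A.support, |F a| ≤ C) :
    Integrable F A.toMeasure :=
  Integrable.of_bound (Measurable.of_discrete.aestronglyMeasurable) C
    (A.ae_toMeasure.mono fun a ha => h a ha)

theorem integrable_arrival (hA : ∀ a ∈ A.support, ∀ i, a i ≤ Amax) (i : Fin 4) :
    Integrable (fun a : Vec => (a i : ℝ)) A.toMeasure :=
  integrable_of_bounded_support (C := Amax) fun a ha => by
    rw [abs_of_nonneg (Nat.cast_nonneg _)]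
    exact_mod_cast hA a ha i

/-- The one-step drift of the square of a quadratic Lyapunov function. -/
theorem integral_sq_next_le (hA : ∀ a ∈ A.support, ∀ i, a i ≤ Amax) {m : Fin 4 → ℝ}
    (hm : ∀ i, ∫ a : Vec, (a i : ℝ) ∂A.toMeasure = m i) {q s : Vec} (hs : IsMaxWeight q s)
    {V : Vec → ℝ} (hV0 : ∀ q, 0 ≤ V q) {r : Fin 4 → ℝ} (hV : V q = ∑ i, r i ^ 2)
    (hVn : ∀ q' : Vec, V q' ≤ ∑ i, (q' i - q i + r i) ^ 2) (hr : ∀ i, r i ≤ q i) :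
    ∫ a, V (next q a s) ^ 2 ∂A.toMeasure ≤ V q ^ 2 + 4 * V q * ∑ i, r i * (m i - fullSched s i)
      + 40 * (Amax + 2) ^ 2 * V q + 32 * (Amax + 2) ^ 4 := by
  set b : ℝ := Amax + 2 with hb
  have hb0 : 0 ≤ b := by positivity
  have hpt : ∀ a ∈ A.support, V (next q a s) ^ 2 ≤ V q ^ 2
      + 4 * V q * ∑ i, r i * (a i - fullSched s i) + 40 * b ^ 2 * V q + 32 * b ^ 4 := by
    intro a ha
    -- Waste is positive only where `q i = 0`, and there `r i ≤ q i` gives `r i ≤ 0`: waste never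
    -- increases the first-order term.
    have hw : ∀ i, |(a i : ℝ) - fullSched s i + waste q a s i| ≤ b ∧
        |(a i : ℝ) - fullSched s i| ≤ b ∧ r i * waste q a s i ≤ 0 := by
      intro i
      have h1 : (fullSched s i : ℝ) ≤ 1 := by exact_mod_cast fullSched_le_one s i
      have h2 : (0 : ℝ) ≤ fullSched s i := Nat.cast_nonneg _
      have h3 : (a i : ℝ) ≤ Amax := by exact_mod_cast hA a ha i
      have h4 : (0 : ℝ) ≤ a i := Nat.cast_nonneg _
      have h5 := hr i
      rcases hs.waste_cases a i with h | ⟨h, hq, -⟩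
      · rw [h]
        refine ⟨abs_le.2 ⟨?_, ?_⟩, abs_le.2 ⟨?_, ?_⟩, ?_⟩ <;> linarith
      · rw [hq, Nat.cast_zero] at h5
        rw [h]
        refine ⟨abs_le.2 ⟨?_, ?_⟩, abs_le.2 ⟨?_, ?_⟩, ?_⟩ <;> linarith
    set S := ∑ i, r i * ((a i : ℝ) - fullSched s i) with hS
    have hX : V (next q a s) ≤ V q + (2 * S + 4 * b ^ 2) := by
      refine (hVn _).trans ?_
      rw [hV, hS, Finset.mul_sum]
      have : (4 : ℝ) * b ^ 2 = ∑ _i : Fin 4, b ^ 2 := by simp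
      rw [this, ← Finset.sum_add_distrib, ← Finset.sum_add_distrib]
      refine Finset.sum_le_sum fun i _ => ?_
      obtain ⟨h1, -, h3⟩ := hw i
      have h4 := sq_le_sq' (abs_le.1 h1).1 (abs_le.1 h1).2
      rw [next_eq_add_waste]
      nlinarith
    have hS2 : S ^ 2 ≤ 4 * b ^ 2 * V q := by
      refine (Finset.sum_mul_sq_le_sq_mul_sq _ _ _).trans ?_
      rw [← hV, mul_comm]
      refine mul_le_mul_of_nonneg_right ?_ (hV0 q)
      have : (4 : ℝ) * b ^ 2 = ∑ _i : Fin 4, b ^ 2 := by simp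
      rw [this]
      exact Finset.sum_le_sum fun i _ => sq_le_sq' (abs_le.1 (hw i).2.1).1 (abs_le.1 (hw i).2.1).2
    have h0 := hV0 (next q a s)
    have h1 : V (next q a s) ^ 2 ≤ (V q + (2 * S + 4 * b ^ 2)) ^ 2 := pow_le_pow_left₀ h0 hX 2
    -- (2S + 4b²)² ≤ 8S² + 32b⁴ ≤ 32b²V + 32b⁴, and the cross term adds 8b²V, whence the constants
    -- 40 and 32.
    nlinarith [sq_nonneg (2 * S - 4 * b ^ 2)]
  have hint : ∀ i, Integrable (fun a : Vec => r i * ((a i : ℝ) - fullSched s i)) A.toMeasure :=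
    fun i => ((integrable_arrival hA i).sub (integrable_const _)).const_mul _
  have hsum : ∫ a : Vec, ∑ i, r i * ((a i : ℝ) - fullSched s i) ∂A.toMeasure
      = ∑ i, r i * (m i - fullSched s i) := by
    rw [integral_finsetSum _ fun i _ => hint i]
    refine Finset.sum_congr rfl fun i _ => ?_
    rw [integral_const_mul, integral_sub (integrable_arrival hA i) (integrable_const _), hm]
    simp
  have hint' : Integrable (fun a : Vec => ∑ i, r i * ((a i : ℝ) - fullSched s i)) A.toMeasure :=
    integrable_finsetSum _ fun i _ => hint i
  calc ∫ a, V (next q a s) ^ 2 ∂A.toMeasure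
      ≤ ∫ a : Vec, ((V q ^ 2 + 40 * b ^ 2 * V q + 32 * b ^ 4)
          + 4 * V q * ∑ i, r i * (a i - fullSched s i)) ∂A.toMeasure := by
        refine integral_mono_of_nonneg (Eventually.of_forall fun a => sq_nonneg _) ?_
          (A.ae_toMeasure.mono fun a ha => (hpt a ha).trans_eq (by ring))
        exact (integrable_const _).add (hint'.const_mul _)
    _ = _ := by
        rw [integral_add (integrable_const _) (hint'.const_mul _), integral_const_mul, hsum]
        simp only [integral_const, probReal_univ, smul_eq_mul, one_mul]
        ring

/-- Either the cubic term dominates, or `x ≤ α / β`. This lets part of a cubic negative drift absorb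
the quadratic error. -/
theorem mul_sq_le_mul_cube_add {α β x : ℝ} (hα : 0 ≤ α) (hβ : 0 < β) (hx : 0 ≤ x) :
    α * x ^ 2 ≤ β * x ^ 3 + α ^ 3 / β ^ 2 := by
  have h0 : 0 ≤ α ^ 3 / β ^ 2 := by positivity
  rcases le_total α (β * x) with h | h
  · nlinarith [mul_le_mul_of_nonneg_right h (sq_nonneg x)]
  · have h1 : x ≤ α / β := by rw [le_div_iff₀ hβ]; linarith
    have h2 : x ^ 2 ≤ (α / β) ^ 2 := pow_le_pow_left₀ hx h1 2
    have h3 : α * x ^ 2 ≤ α ^ 3 / β ^ 2 := by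
      calc α * x ^ 2 ≤ α * (α / β) ^ 2 := by gcongr
        _ = _ := by rw [div_pow]; ring
    have : 0 ≤ β * x ^ 3 := by positivity
    linarith

/-- The constant in the moment bounds obtained from `transition_drift`. -/
noncomputable def driftConst (Amax : ℕ) (c K : ℝ) : ℝ :=
  32 * (Amax + 2) ^ 4 + (40 * (Amax + 2) ^ 2 * K) ^ 3 / (2 * c / K) ^ 2

/-- The drift inequality of the square of a quadratic Lyapunov function `V`, when `V` has a drift
at most `-c n` for some `n` comparable with `√V`. -/
theorem transition_drift (p : MaxWeightPolicy) (hA : ∀ a ∈ A.support, ∀ i, a i ≤ Amax)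
    {m : Fin 4 → ℝ} (hm : ∀ i, ∫ a : Vec, (a i : ℝ) ∂A.toMeasure = m i)
    {V n : Vec → ℝ} {r : Vec → Fin 4 → ℝ} {c K : ℝ} (hc : 0 < c) (hK : 0 < K)
    (hV : ∀ q, V q = ∑ i, r q i ^ 2)
    (hVn : ∀ q q' : Vec, V q' ≤ ∑ i, (q' i - q i + r q i) ^ 2) (hr : ∀ q i, r q i ≤ q i)
    (hn : ∀ q, 0 ≤ n q) (hnV : ∀ q, n q ^ 2 ≤ K * V q) (hVn' : ∀ q, V q ≤ K * n q ^ 2)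
    (hdrift : ∀ q s, IsMaxWeight q s → ∑ i, r q i * (m i - fullSched s i) ≤ -c * n q) (q : Vec) :
    ∑' y, transition A p q y * ENNReal.ofReal (V y ^ 2) + ENNReal.ofReal (2 * c / K * n q ^ 3)
      ≤ ENNReal.ofReal (V q ^ 2) + ENNReal.ofReal (driftConst Amax c K) := by
  have hV0 : ∀ q, 0 ≤ V q := fun q => by rw [hV]; positivity
  rw [tsum_transition_mul, ← one_mul (ENNReal.ofReal (2 * c / K * n q ^ 3)),
    ← (p.sched q).tsum_coe, ← ENNReal.tsum_mul_right, ← ENNReal.tsum_add]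
  simp only [← mul_add]
  refine PMF.tsum_mul_le_of_forall_le _ fun s hs => ?_
  have hs := p.isMaxWeight q s hs
  have h1 := integral_sq_next_le hA hm hs hV0 (hV q) (hVn q) (hr q)
  have hint : Integrable (fun a => V (next q a s) ^ 2) A.toMeasure := by
    have hfin : {a : Vec | ∀ i, a i ≤ Amax}.Finite := by
      have := Set.finite_Iic (fun _ : Fin 4 => Amax)
      exact this
    obtain ⟨C, hC⟩ := (hfin.image fun a => |V (next q a s) ^ 2|).bddAbove
    exact integrable_of_bounded_support (C := C) fun a ha =>
      hC (mem_image_of_mem _ (hA a ha))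
  have h2 : ∑' a, A a * ENNReal.ofReal (V (next q a s) ^ 2)
      = ENNReal.ofReal (∫ a, V (next q a s) ^ 2 ∂A.toMeasure) := by
    rw [ofReal_integral_eq_lintegral_ofReal hint (Eventually.of_forall fun a => sq_nonneg _),
      PMF.lintegral_toMeasure]
  have hd : 0 ≤ driftConst Amax c K := by unfold driftConst; positivity
  have hn3 : 0 ≤ 2 * c / K * n q ^ 3 := by have := hn q; positivity
  rw [h2, ← ENNReal.ofReal_add (integral_nonneg fun a => sq_nonneg _) hn3,
    ← ENNReal.ofReal_add (sq_nonneg _) hd]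
  refine ENNReal.ofReal_le_ofReal ?_
  have h3 := mul_sq_le_mul_cube_add (α := 40 * (Amax + 2) ^ 2 * K) (β := 2 * c / K)
    (by positivity) (by positivity) (hn q)
  have h4 := mul_le_mul_of_nonneg_left (hdrift q s hs) (mul_nonneg (zero_le_four (α := ℝ)) (hV0 q))
  -- The available drift is twice the claimed rate; the other half pays for the term in `n q ^ 2`.
  have h5 : 4 * c / K * n q ^ 3 ≤ 4 * c * n q * V q := by
    calc 4 * c / K * n q ^ 3 = 4 * c * n q * (n q ^ 2 / K) := by ring
      _ ≤ _ := by
        have := hn q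
        gcongr
        rw [div_le_iff₀ hK, mul_comm]
        exact hnV q
  have h6 : 40 * ((Amax : ℝ) + 2) ^ 2 * V q ≤ 40 * (Amax + 2) ^ 2 * K * n q ^ 2 := by
    rw [mul_assoc _ K]
    gcongr
    exact hVn' q
  have h7 : 4 * c / K * n q ^ 3 = 2 * (2 * c / K * n q ^ 3) := by ring
  unfold driftConst
  linarith

end Arrivals

/-! ### The two Lyapunov functions -/

/-- The total queue length. -/
def total (q : Vec) : ℝ := q 0 + q 1 + q 2 + q 3

/-- The imbalance between the two full schedules. -/
def imbalance (q : Vec) : ℝ := q 0 - q 1 - q 2 + q 3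

/-- On lattice points the squared distance is a natural number, so a minimizer exists by
well-foundedness. Natural entries also matter for the drift: `y i ≥ 0` gives `q i - y i ≤ q i`,
which projection to the whole hyperplane would not guarantee. -/
theorem exists_nearest_balanced (q : Vec) : ∃ y : Vec, y 0 + y 3 = y 1 + y 2 ∧
    ∀ y' : Vec, y' 0 + y' 3 = y' 1 + y' 2 →
      ∑ i, ((q i : ℝ) - y i) ^ 2 ≤ ∑ i, ((q i : ℝ) - y' i) ^ 2 := by
  have hcast : ∀ y : Vec, ∑ i, ((q i : ℝ) - y i) ^ 2
      = ((∑ i, ((q i : ℤ) - y i).natAbs ^ 2 : ℕ) : ℝ) := by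
    intro y
    push_cast
    refine Finset.sum_congr rfl fun i _ => ?_
    rw [Nat.cast_natAbs]
    push_cast
    rw [sq_abs]
  have hne : {y : Vec | y 0 + y 3 = y 1 + y 2}.Nonempty := ⟨0, rfl⟩
  obtain ⟨y, hy, hmin⟩ := exists_minimalFor_of_wellFoundedLT
    (fun y : Vec => y 0 + y 3 = y 1 + y 2) (fun y => ∑ i, ((q i : ℤ) - y i).natAbs ^ 2) hne
  refine ⟨y, hy, fun y' hy' => ?_⟩
  rw [hcast, hcast]
  rcases le_total (∑ i, ((q i : ℤ) - y i).natAbs ^ 2) (∑ i, ((q i : ℤ) - y' i).natAbs ^ 2)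
    with h | h
  · exact_mod_cast h
  · exact_mod_cast hmin hy' h

/-- A balanced queue length vector nearest to `q`. -/
noncomputable def nearestBalanced (q : Vec) : Vec := (exists_nearest_balanced q).choose

theorem nearestBalanced_balanced (q : Vec) :
    nearestBalanced q 0 + nearestBalanced q 3 = nearestBalanced q 1 + nearestBalanced q 2 :=
  (exists_nearest_balanced q).choose_spec.1

theorem nearestBalanced_le (q y : Vec) (hy : y 0 + y 3 = y 1 + y 2) :
    ∑ i, ((q i : ℝ) - nearestBalanced q i) ^ 2 ≤ ∑ i, ((q i : ℝ) - y i) ^ 2 :=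
  (exists_nearest_balanced q).choose_spec.2 y hy

/-- Removing the excess z from the heavier diagonal, split as k + l = z between its two queues,
gives a balanced competitor at squared distance k² + l² ≤ z². -/
theorem sum_sub_nearestBalanced_sq_le (q : Vec) :
    ∑ i, ((q i : ℝ) - nearestBalanced q i) ^ 2 ≤ imbalance q ^ 2 := by
  have hreal : ∀ {k l z : ℕ}, k + l = z → ((k : ℝ)) ^ 2 + (l : ℝ) ^ 2 ≤ (z : ℝ) ^ 2 := by
    intro k l z h
    have h : (k : ℝ) + l = z := by exact_mod_cast h
    have h1 : (0 : ℝ) ≤ k := Nat.cast_nonneg _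
    have h2 : (0 : ℝ) ≤ l := Nat.cast_nonneg _
    rw [← h]
    nlinarith [mul_nonneg h1 h2]
  rcases le_total (q 1 + q 2) (q 0 + q 3) with h | h
  · obtain ⟨z, hz⟩ := Nat.exists_eq_add_of_le h
    obtain ⟨k, l, hkl, hk, hl⟩ : ∃ k l, k + l = z ∧ k ≤ q 0 ∧ l ≤ q 3 :=
      ⟨min z (q 0), z - min z (q 0), by omega, by omega, by omega⟩
    have hzr : imbalance q = z := by
      have : (q 0 : ℝ) + q 3 = q 1 + q 2 + z := by exact_mod_cast hz
      unfold imbalance; linarith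
    refine (nearestBalanced_le q ![q 0 - k, q 1, q 2, q 3 - l] ?_).trans ?_
    · simp; omega
    · rw [hzr]
      simp [Fin.sum_univ_four, Nat.cast_sub hk, Nat.cast_sub hl]
      exact hreal hkl
  · obtain ⟨z, hz⟩ := Nat.exists_eq_add_of_le h
    obtain ⟨k, l, hkl, hk, hl⟩ : ∃ k l, k + l = z ∧ k ≤ q 1 ∧ l ≤ q 2 :=
      ⟨min z (q 1), z - min z (q 1), by omega, by omega, by omega⟩
    have hzr : imbalance q = -z := by
      have : (q 1 : ℝ) + q 2 = q 0 + q 3 + z := by exact_mod_cast hz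
      unfold imbalance; linarith
    refine (nearestBalanced_le q ![q 0, q 1 - k, q 2 - l, q 3] ?_).trans ?_
    · simp; omega
    · rw [hzr]
      simp [Fin.sum_univ_four, Nat.cast_sub hk, Nat.cast_sub hl]
      exact hreal hkl

/-! ### Negative drift of the total and of the imbalance -/

section Drift

variable {A : PMF Vec} {Amax : ℕ} {ν : Fin 4 → ℝ} {ε : ℝ}

/-- Drift of the total queue length, valid for every load below saturation. -/
theorem total_drift (p : MaxWeightPolicy) (hA : ∀ a ∈ A.support, ∀ i, a i ≤ Amax)
    (hν0 : 0 < ν 0) (hν1 : 0 < ν 1) (h01 : ν 0 + ν 1 = 1) (h2 : ν 2 = ν 1) (h3 : ν 3 = ν 0)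
    (hε : 0 < ε)
    (hm : ∀ i, ∫ a : Vec, (a i : ℝ) ∂A.toMeasure = (1 - ε) * ν i) (q : Vec) :
    ∑' y, transition A p q y * ENNReal.ofReal ((∑ i, (y i : ℝ) ^ 2) ^ 2)
        + ENNReal.ofReal (2 * (ε * min (ν 0) (ν 1)) / 4 * total q ^ 3)
      ≤ ENNReal.ofReal ((∑ i, (q i : ℝ) ^ 2) ^ 2)
        + ENNReal.ofReal (driftConst Amax (ε * min (ν 0) (ν 1)) 4) := by
  refine transition_drift (V := fun q => ∑ i, (q i : ℝ) ^ 2) (r := fun q i => q i) p hA hm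
    (mul_pos hε (lt_min hν0 hν1)) (by norm_num) (fun q => rfl)
    (fun q q' => by simp) (fun q i => le_rfl) (fun q => by unfold total; positivity)
    (fun q => ?_) (fun q => ?_) (fun q s hs => ?_) q
  · simp only [Fin.sum_univ_four, total]
    nlinarith [sq_nonneg ((q 0 : ℝ) - q 1), sq_nonneg ((q 0 : ℝ) - q 2),
      sq_nonneg ((q 0 : ℝ) - q 3), sq_nonneg ((q 1 : ℝ) - q 2), sq_nonneg ((q 1 : ℝ) - q 3),
      sq_nonneg ((q 2 : ℝ) - q 3)]
  · simp only [Fin.sum_univ_four, total]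
    have k0 : (0 : ℝ) ≤ q 0 := Nat.cast_nonneg _
    have k1 : (0 : ℝ) ≤ q 1 := Nat.cast_nonneg _
    have k2 : (0 : ℝ) ≤ q 2 := Nat.cast_nonneg _
    have k3 : (0 : ℝ) ≤ q 3 := Nat.cast_nonneg _
    nlinarith [mul_nonneg k0 k1, mul_nonneg k0 k2, mul_nonneg k0 k3, mul_nonneg k1 k2,
      mul_nonneg k1 k3, mul_nonneg k2 k3]
  · have k0 : (0 : ℝ) ≤ q 0 + q 3 := by positivity
    have k1 : (0 : ℝ) ≤ q 1 + q 2 := by positivity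
    have l0 := mul_le_mul_of_nonneg_right (min_le_left (ν 0) (ν 1)) k0
    have l1 := mul_le_mul_of_nonneg_right (min_le_right (ν 0) (ν 1)) k1
    -- The saturated load `ν` has nonpositive drift against the heavier permutation; strict
    -- negativity comes only from the deficit ε⟨q, ν⟩.
    have hle : min (ν 0) (ν 1) * total q ≤ ν 0 * (q 0 + q 3) + ν 1 * (q 1 + q 2) := by
      unfold total; nlinarith
    have hle' := mul_le_mul_of_nonneg_left hle hε.le
    rcases hs.fullSched_cases with ⟨h, hq⟩ | ⟨h, hq⟩
    · have hq' : (q 1 : ℝ) + q 2 ≤ q 0 + q 3 := by exact_mod_cast hq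
      have := mul_le_mul_of_nonneg_left hq' hν1.le
      simp only [Fin.sum_univ_four, h, h2, h3]
      simp
      have : q 0 * ((1 - ε) * ν 0 - 1) + q 1 * ((1 - ε) * ν 1) + q 2 * ((1 - ε) * ν 1)
          + q 3 * ((1 - ε) * ν 0 - 1) = ν 1 * (q 1 + q 2) - ν 1 * (q 0 + q 3)
            - ε * (ν 0 * (q 0 + q 3) + ν 1 * (q 1 + q 2)) := by
        linear_combination ((q 0 : ℝ) + q 3) * h01
      linarith
    · have hq' : (q 0 : ℝ) + q 3 ≤ q 1 + q 2 := by exact_mod_cast hq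
      have := mul_le_mul_of_nonneg_left hq' hν0.le
      simp only [Fin.sum_univ_four, h, h2, h3]
      simp
      have : q 0 * ((1 - ε) * ν 0) + q 1 * ((1 - ε) * ν 1 - 1) + q 2 * ((1 - ε) * ν 1 - 1)
          + q 3 * ((1 - ε) * ν 0) = ν 0 * (q 0 + q 3) - ν 0 * (q 1 + q 2)
            - ε * (ν 0 * (q 0 + q 3) + ν 1 * (q 1 + q 2)) := by
        linear_combination ((q 1 : ℝ) + q 2) * h01
      linarith

/-- Drift of the imbalance, uniform over loads close to saturation. -/
theorem imbalance_drift (p : MaxWeightPolicy) (hA : ∀ a ∈ A.support, ∀ i, a i ≤ Amax)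
    (hν0 : 0 < ν 0) (hν1 : 0 < ν 1) (h01 : ν 0 + ν 1 = 1) (h2 : ν 2 = ν 1) (h3 : ν 3 = ν 0)
    (hε : 0 < ε) (hε1 : ε ≤ min (ν 0) (ν 1) / 4)
    (hm : ∀ i, ∫ a : Vec, (a i : ℝ) ∂A.toMeasure = (1 - ε) * ν i) (q : Vec) :
    ∑' y, transition A p q y
          * ENNReal.ofReal ((∑ i, ((y i : ℝ) - nearestBalanced y i) ^ 2) ^ 2)
        + ENNReal.ofReal (2 * (min (ν 0) (ν 1) / 2) / 4 * |imbalance q| ^ 3)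
      ≤ ENNReal.ofReal ((∑ i, ((q i : ℝ) - nearestBalanced q i) ^ 2) ^ 2)
        + ENNReal.ofReal (driftConst Amax (min (ν 0) (ν 1) / 2) 4) := by
  have hmin := lt_min hν0 hν1
  refine transition_drift (V := fun q => ∑ i, ((q i : ℝ) - nearestBalanced q i) ^ 2)
    (r := fun q i => (q i : ℝ) - nearestBalanced q i) (n := fun q => |imbalance q|) p hA hm
    (half_pos hmin) (by norm_num) (fun q => rfl)
    (fun q q' => ?_) (fun q i => by simp) (fun q => abs_nonneg _)
    (fun q => ?_) (fun q => ?_) (fun q s hs => ?_) q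
  · refine (nearestBalanced_le q' (nearestBalanced q) (nearestBalanced_balanced q)).trans_eq ?_
    refine Finset.sum_congr rfl fun i _ => ?_
    ring
  · have hb : (nearestBalanced q 0 : ℝ) + nearestBalanced q 3
        = nearestBalanced q 1 + nearestBalanced q 2 := by exact_mod_cast nearestBalanced_balanced q
    have : imbalance q = (q 0 - nearestBalanced q 0) - (q 1 - nearestBalanced q 1)
        - (q 2 - nearestBalanced q 2) + (q 3 - nearestBalanced q 3) := by
      unfold imbalance; linarith
    rw [sq_abs, this]
    simp only [Fin.sum_univ_four]
    generalize (q 0 : ℝ) - nearestBalanced q 0 = a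
    generalize (q 1 : ℝ) - nearestBalanced q 1 = b
    generalize (q 2 : ℝ) - nearestBalanced q 2 = c
    generalize (q 3 : ℝ) - nearestBalanced q 3 = d
    nlinarith [sq_nonneg (a + b), sq_nonneg (a + c), sq_nonneg (a - d), sq_nonneg (b - c),
      sq_nonneg (b + d), sq_nonneg (c + d)]
  · have := sum_sub_nearestBalanced_sq_le q
    rw [sq_abs]
    nlinarith [sq_nonneg (imbalance q)]
  · have hb : (nearestBalanced q 0 : ℝ) + nearestBalanced q 3
        = nearestBalanced q 1 + nearestBalanced q 2 := by exact_mod_cast nearestBalanced_balanced q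
    have hz : imbalance q = (q 0 - nearestBalanced q 0) - (q 1 - nearestBalanced q 1)
        - (q 2 - nearestBalanced q 2) + (q 3 - nearestBalanced q 3) := by
      unfold imbalance; linarith
    have hle := sum_sub_nearestBalanced_sq_le q
    simp only [Fin.sum_univ_four] at hle ⊢
    have hz0 := hs.fullSched_cases
    have hz1 : (fullSched s = ![1, 0, 0, 1] ∧ 0 ≤ imbalance q) ∨
        (fullSched s = ![0, 1, 1, 0] ∧ imbalance q ≤ 0) := by
      rcases hz0 with ⟨h, hq⟩ | ⟨h, hq⟩
      · have hq' : (q 1 : ℝ) + q 2 ≤ q 0 + q 3 := by exact_mod_cast hq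
        exact Or.inl ⟨h, by unfold imbalance; linarith⟩
      · have hq' : (q 0 : ℝ) + q 3 ≤ q 1 + q 2 := by exact_mod_cast hq
        exact Or.inr ⟨h, by unfold imbalance; linarith⟩
    clear hz0 hb
    rw [h2, h3]
    generalize (q 0 : ℝ) - nearestBalanced q 0 = a at *
    generalize (q 1 : ℝ) - nearestBalanced q 1 = b at *
    generalize (q 2 : ℝ) - nearestBalanced q 2 = c at *
    generalize (q 3 : ℝ) - nearestBalanced q 3 = d at *
    generalize imbalance q = z at *
    have hP : |a + d| ≤ 2 * |z| := by
      rw [← abs_two (α := ℝ), ← abs_mul]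
      refine sq_le_sq.1 ?_
      nlinarith [sq_nonneg (a - d), sq_nonneg b, sq_nonneg c, sq_nonneg z]
    have hM : |b + c| ≤ 2 * |z| := by
      rw [← abs_two (α := ℝ), ← abs_mul]
      refine sq_le_sq.1 ?_
      nlinarith [sq_nonneg (b - c), sq_nonneg a, sq_nonneg d, sq_nonneg z]
    -- MaxWeight gives drift at most -min(ν₀, ν₁)|z| at saturation. The load deficit perturbs it by
    -- at most 2ε|z|, which is half of that when ε ≤ min(ν₀, ν₁)/4.
    have hPM : -(2 * |z|) ≤ ν 0 * (a + d) + ν 1 * (b + c) := by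
      have i0 := mul_le_mul_of_nonneg_left (abs_le.1 hP).1 hν0.le
      have i1 := mul_le_mul_of_nonneg_left (abs_le.1 hM).1 hν1.le
      have : ν 0 * -(2 * |z|) + ν 1 * -(2 * |z|) = -(2 * |z|) := by
        linear_combination (-(2 * |z|)) * h01
      linarith
    have hE := mul_le_mul_of_nonneg_left hPM hε.le
    have hE2 := mul_le_mul_of_nonneg_right hε1 (abs_nonneg z)
    rcases hz1 with ⟨h, hq⟩ | ⟨h, hq⟩
    · rw [abs_of_nonneg hq] at *
      have h5 := mul_le_mul_of_nonneg_right (min_le_right (ν 0) (ν 1)) hq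
      rw [h]
      simp
      have : a * ((1 - ε) * ν 0 - 1) + b * ((1 - ε) * ν 1) + c * ((1 - ε) * ν 1)
          + d * ((1 - ε) * ν 0 - 1) = -(ν 1 * z) - ε * (ν 0 * (a + d) + ν 1 * (b + c)) := by
        have e2 : ν 0 = 1 - ν 1 := by linarith
        rw [e2, hz]; ring
      linarith
    · rw [abs_of_nonpos hq] at *
      have h5 := mul_le_mul_of_nonpos_right (min_le_left (ν 0) (ν 1)) hq
      rw [h]
      simp
      have : a * ((1 - ε) * ν 0) + b * ((1 - ε) * ν 1 - 1) + c * ((1 - ε) * ν 1 - 1)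
          + d * ((1 - ε) * ν 0) = (ν 0 * z) - ε * (ν 0 * (a + d) + ν 1 * (b + c)) := by
        have e2 : ν 1 = 1 - ν 0 := by linarith
        rw [e2, hz]; ring
      linarith

end Drift

end InputQueuedSwitch

/-! ### Integrability, and access to the empty state -/

namespace InputQueuedSwitch

theorem integrable_of_tsum_le {π : PMF Vec} {n : Vec → ℝ} {c C : ℝ} (hc : 0 < c) (hC : 0 ≤ C)
    (hn : ∀ q, 0 ≤ n q)
    (h : ∑' q, π q * ENNReal.ofReal (c * n q) ≤ ENNReal.ofReal C) :
    Integrable n π.toMeasure ∧ ∫ q, n q ∂π.toMeasure ≤ C / c := by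
  rw [← PMF.lintegral_toMeasure] at h
  have hnn : ∀ q, 0 ≤ c * n q := fun q => mul_nonneg hc.le (hn q)
  have hint : Integrable (fun q => c * n q) π.toMeasure := by
    refine ⟨Measurable.of_discrete.aestronglyMeasurable, ?_⟩
    rw [hasFiniteIntegral_iff_ofReal (Eventually.of_forall hnn)]
    exact h.trans_lt ENNReal.ofReal_lt_top
  refine ⟨by simpa [hc.ne'] using hint.const_mul c⁻¹, ?_⟩
  rw [← ofReal_integral_eq_lintegral_ofReal hint (Eventually.of_forall hnn),
    ENNReal.ofReal_le_ofReal_iff hC, integral_const_mul] at h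
  rw [le_div_iff₀ hc]
  linarith

theorem total_nonneg (q : Vec) : 0 ≤ total q := by unfold total; positivity

theorem le_total (q : Vec) (i : Fin 4) : (q i : ℝ) ≤ total q := by
  have h : ∀ j, (0 : ℝ) ≤ q j := fun j => Nat.cast_nonneg _
  unfold total
  fin_cases i <;> simp <;> linarith [h 0, h 1, h 2, h 3]

theorem total_le_one_add_cube (q : Vec) : total q ≤ 1 + total q ^ 3 := by
  have h4 := total_nonneg q
  nlinarith [sq_nonneg (total q - 1), mul_nonneg h4 (sq_nonneg (total q - 1))]

theorem finite_total_sublevel {c : ℝ} (hc : 0 < c) (M : ℕ) :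
    {q : Vec | ENNReal.ofReal (c * total q ^ 3) ≤ M}.Finite := by
  refine (Set.finite_Iic (fun _ : Fin 4 => ⌈(M : ℝ) / c⌉₊ + 1)).subset fun q hq => ?_
  intro i
  have h1 : c * total q ^ 3 ≤ M := by
    have : ENNReal.ofReal (c * total q ^ 3) ≤ ENNReal.ofReal M := by simpa using hq
    exact (ENNReal.ofReal_le_ofReal_iff (Nat.cast_nonneg _)).1 this
  have h2 : total q ^ 3 ≤ M / c := by rw [le_div_iff₀ hc]; linarith
  have h3 := Nat.le_ceil ((M : ℝ) / c)
  have h4 := total_le_one_add_cube q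
  have : (q i : ℝ) ≤ ((⌈(M : ℝ) / c⌉₊ + 1 : ℕ) : ℝ) := by
    push_cast
    linarith [le_total q i]
  exact_mod_cast this

/-- Every invariant measure of the switch that is not zero charges the empty state. -/
theorem eq_zero_of_invariant {A : PMF Vec} {p : MaxWeightPolicy} (hA : A 0 ≠ 0)
    (m : Vec → ℝ≥0∞) (hm : ∀ y, ∑' x, m x * transition A p x y = m y) (h0 : m 0 = 0)
    (q : Vec) : m q = 0 := by
  induction hk : ∑ i, q i using Nat.strong_induction_on generalizing q with
  | _ k ih =>
    by_cases hq : q = 0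
    · rw [hq, h0]
    obtain ⟨i, hi⟩ : ∃ i, q i ≠ 0 := by
      by_contra hcon
      push Not at hcon
      exact hq (funext hcon)
    obtain ⟨s, hs⟩ := (p.sched q).support_nonempty
    have hmw := p.isMaxWeight q s hs
    have hnext : ∀ j, next q 0 s j = q j - s j := by
      intro j
      simp only [next, unused, Pi.zero_apply]
      omega
    -- Serving one nonempty queue is feasible, so MaxWeight has positive weight: without arrivals
    -- the total strictly decreases, and invariance carries the null mass of the smaller state back
    -- to `q`.
    have hpos : 0 < ∑ j, q j * s j := by
      have hf : Feasible (Pi.single i 1) := by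
        refine ⟨fun j => ?_, ?_⟩
        · by_cases hj : j = i <;> simp [hj]
        · fin_cases i <;> simp
      refine lt_of_lt_of_le ?_ (hmw.2 _ hf)
      simp [Pi.single_apply]
      omega
    obtain ⟨j, -, hj⟩ : ∃ j ∈ Finset.univ, 0 < q j * s j := by
      by_contra hcon
      push Not at hcon
      exact hpos.ne' (Finset.sum_eq_zero fun j hj => Nat.le_zero.1 (hcon j hj))
    have hlt : ∑ j, next q 0 s j < k := by
      rw [← hk]
      refine Finset.sum_lt_sum (fun l _ => by rw [hnext]; omega) ⟨j, Finset.mem_univ j, ?_⟩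
      rw [hnext]
      have h1 := Nat.pos_of_mul_pos_left hj
      have h2 := Nat.pos_of_mul_pos_right hj
      omega
    have h1 := ih _ hlt (next q 0 s) rfl
    rw [← hm, ENNReal.tsum_eq_zero] at h1
    refine (mul_eq_zero.1 (h1 q)).resolve_right ?_
    change transition A p q (next q 0 s) ≠ 0
    rw [← PMF.mem_support_iff]
    unfold transition
    rw [PMF.mem_support_bind_iff]
    refine ⟨s, hs, ?_⟩
    rw [PMF.mem_support_map_iff]
    exact ⟨0, hA, rfl⟩

/-- An integer-valued arrival with mean below 1 vanishes with positive probability; independence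
multiplies the four probabilities. -/
theorem apply_zero_ne_zero {A : PMF Vec} {Amax : ℕ} (hA : ∀ a ∈ A.support, ∀ i, a i ≤ Amax)
    (hind : iIndepFun (fun (i : Fin 4) (a : Vec) => a i) A.toMeasure)
    (hm : ∀ i, ∫ a : Vec, (a i : ℝ) ∂A.toMeasure < 1) : A 0 ≠ 0 := by
  have hi : ∀ i : Fin 4, A.toMeasure ((fun a : Vec => a i) ⁻¹' {0}) ≠ 0 := by
    intro i hzero
    have h1 : ∀ᵐ a : Vec ∂A.toMeasure, (1 : ℝ) ≤ a i := by
      rw [ae_iff]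
      refine measure_mono_null (fun a ha => ?_) hzero
      rw [mem_ofPred_eq, not_le] at ha
      have : a i < 1 := by exact_mod_cast ha
      simpa using this
    have h2 := integral_mono_ae (integrable_const (1 : ℝ)) (integrable_arrival hA i) h1
    simp only [integral_const, probReal_univ, smul_eq_mul, mul_one] at h2
    exact absurd (hm i) (not_lt.2 h2)
  have h := hind.measure_inter_preimage_eq_mul Finset.univ (sets := fun _ => {0})
    fun _ _ => measurableSet_singleton _
  have hset : (⋂ i ∈ (Finset.univ : Finset (Fin 4)), (fun a : Vec => a i) ⁻¹' {0}) = {0} := by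
    ext a
    simp [funext_iff]
  rw [hset, PMF.toMeasure_apply_singleton _ _ (measurableSet_singleton _)] at h
  rw [h]
  exact Finset.prod_ne_zero_iff.2 fun i _ => hi i

/-! ### The stationary slot -/

/-- The joint law, in one time slot, of the queue lengths and schedule (paired) and the arrivals. -/
noncomputable def slotLaw (A : PMF Vec) (p : MaxWeightPolicy) (π : PMF Vec) :
    Measure ((Vec × Vec) × Vec) :=
  (π.bind fun q => (p.sched q).map fun s => (q, s)).toMeasure.prod A.toMeasure

section Slot

variable {A : PMF Vec} {p : MaxWeightPolicy} {π : PMF Vec} {Amax : ℕ}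

instance : IsProbabilityMeasure (slotLaw A p π) := by unfold slotLaw; infer_instance

theorem measurePreserving_arrivals :
    MeasurePreserving (fun ω : (Vec × Vec) × Vec => ω.2) (slotLaw A p π) A.toMeasure :=
  measurePreserving_snd

theorem tsum_queueSched_mul (g : Vec × Vec → ℝ≥0∞) :
    ∑' x, (π.bind fun q => (p.sched q).map fun s => (q, s)) x * g x
      = ∑' q, π q * ∑' s, p.sched q s * g (q, s) := by
  rw [PMF.tsum_bind_mul]
  refine tsum_congr fun q => ?_
  rw [PMF.map, PMF.tsum_bind_mul]
  congr 1
  refine tsum_congr fun s => ?_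
  congr 1
  rw [tsum_eq_single (q, s)]
  · simp
  · intro y hy
    simp [hy]

theorem measurePreserving_queue :
    MeasurePreserving (fun ω : (Vec × Vec) × Vec => ω.1.1) (slotLaw A p π) π.toMeasure := by
  refine MeasurePreserving.comp (g := Prod.fst) (f := Prod.fst) ?_ measurePreserving_fst
  refine ⟨Measurable.of_discrete, Measure.ext_of_lintegral _ fun g _ => ?_⟩
  rw [lintegral_map Measurable.of_discrete Measurable.of_discrete, PMF.lintegral_toMeasure,
    PMF.lintegral_toMeasure, tsum_queueSched_mul]
  simp only [ENNReal.tsum_mul_right, PMF.tsum_coe, one_mul]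

theorem measurePreserving_next (hπ : IsSteadyState A p π) :
    MeasurePreserving (fun ω : (Vec × Vec) × Vec => next ω.1.1 ω.2 ω.1.2) (slotLaw A p π)
      π.toMeasure := by
  refine ⟨Measurable.of_discrete, Measure.ext_of_lintegral _ fun g _ => ?_⟩
  rw [lintegral_map Measurable.of_discrete Measurable.of_discrete]
  unfold slotLaw
  rw [lintegral_prod _ Measurable.of_discrete.aemeasurable, PMF.lintegral_toMeasure,
    PMF.lintegral_toMeasure, tsum_queueSched_mul]
  simp only [PMF.lintegral_toMeasure, ← tsum_transition_mul]
  rw [← PMF.tsum_bind_mul, hπ]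

theorem ae_slotLaw : ∀ᵐ ω ∂slotLaw A p π, IsMaxWeight ω.1.1 ω.1.2 ∧ ω.2 ∈ A.support := by
  have h1 : ∀ᵐ ω ∂slotLaw A p π, ω.2 ∈ A.support :=
    measurePreserving_arrivals.quasiMeasurePreserving.ae A.ae_toMeasure
  have h2 : ∀ᵐ ω ∂slotLaw A p π,
      ω.1 ∈ (π.bind fun q => (p.sched q).map fun s => (q, s)).support :=
    (measurePreserving_fst (μ := (π.bind fun q => (p.sched q).map fun s => (q, s)).toMeasure)
      (ν := A.toMeasure)).quasiMeasurePreserving.ae (PMF.ae_toMeasure _)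
  filter_upwards [h1, h2] with ω ha hs
  refine ⟨?_, ha⟩
  rw [PMF.mem_support_bind_iff] at hs
  obtain ⟨q, -, hs⟩ := hs
  rw [PMF.mem_support_map_iff] at hs
  obtain ⟨s, hs, he⟩ := hs
  rw [← he]
  exact p.isMaxWeight q s hs

end Slot

/-- The squared norm of the projection of `x` to the span of the row and column vectors. -/
noncomputable def projSq (x : Fin 4 → ℝ) : ℝ :=
  x 0 ^ 2 + x 1 ^ 2 + x 2 ^ 2 + x 3 ^ 2 - (x 0 - x 1 - x 2 + x 3) ^ 2 / 4

/-- The coordinates of the projection of `x` to the span of the row and column vectors. -/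
noncomputable def projCoord (x : Fin 4 → ℝ) (j : Fin 4) : ℝ :=
  x j - (![1, -1, -1, 1] : Fin 4 → ℝ) j * (x 0 - x 1 - x 2 + x 3) / 4

/-- The service that is wasted during a slot. -/
def totalWaste (ω : (Vec × Vec) × Vec) : ℝ :=
  total (next ω.1.1 ω.2 ω.1.2) - total ω.1.1 - total ω.2 + 2

/-- The contribution of the wasted service to the one-step change of `projSq`. -/
noncomputable def wasteTerm (ω : (Vec × Vec) × Vec) : ℝ :=
  projSq (fun i => next ω.1.1 ω.2 ω.1.2 i) - projSq (fun i => ω.1.1 i)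
    - 2 * ∑ j, projCoord (fun i => ω.1.1 i) j * ω.2 j + total ω.1.1
    - (projSq (fun i => ω.2 i) - total ω.2 + 1)

/-- Writing w for the waste, the term is 2⟨proj q⁺, w⟩ - |proj w|². The products q⁺ᵢwᵢ are at most
`Amax` wᵢ, so only the product of the imbalances of q⁺ and w needs Young's inequality. The parameter
`t` is left free for later optimization. -/
theorem abs_wasteTerm_le {Amax : ℕ} {ω : (Vec × Vec) × Vec} (h : IsMaxWeight ω.1.1 ω.1.2)
    (ha : ∀ i, ω.2 i ≤ Amax) {t : ℝ} (ht : 0 < t) :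
    |wasteTerm ω| ≤ (2 * Amax + 1 + t⁻¹) * totalWaste ω
      + t / 4 * imbalance (next ω.1.1 ω.2 ω.1.2) ^ 2 := by
  obtain ⟨⟨q, s⟩, a⟩ := ω
  simp only at h ha ⊢
  have hv : ∀ i, 0 ≤ waste q a s i ∧ waste q a s i ≤ 1 ∧
      waste q a s i ^ 2 = waste q a s i ∧
      0 ≤ next q a s i * waste q a s i ∧ next q a s i * waste q a s i ≤ Amax * waste q a s i := by
    intro i
    rcases h.waste_cases a i with h | ⟨h, -, hn⟩
    · rw [h]; norm_num
    · rw [h]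
      have : (next q a s i : ℝ) ≤ Amax := by exact_mod_cast hn.trans (ha i)
      refine ⟨by norm_num, by norm_num, by norm_num, ?_, ?_⟩
      · positivity
      · linarith
  have hn := next_eq_add_waste q a s
  have hW : totalWaste ((q, s), a) = waste q a s 0 + waste q a s 1 + waste q a s 2
      + waste q a s 3 := by
    simp only [totalWaste, total]
    rw [hn, hn, hn, hn]
    rcases fullSched_cases s with hs | hs <;> rw [hs] <;> simp <;> ring
  have hR : wasteTerm ((q, s), a) = 2 * (next q a s 0 * waste q a s 0
        + next q a s 1 * waste q a s 1 + next q a s 2 * waste q a s 2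
        + next q a s 3 * waste q a s 3)
      - imbalance (next q a s) * (waste q a s 0 - waste q a s 1 - waste q a s 2 + waste q a s 3) / 2
      - projSq (waste q a s) := by
    simp only [wasteTerm, projSq, projCoord, total, imbalance, Fin.sum_univ_four]
    rw [hn, hn, hn, hn]
    rcases fullSched_cases s with hs | hs <;> rw [hs] <;> simp <;> ring
  rw [hW, hR]
  obtain ⟨a0, b0, c0, d0, e0⟩ := hv 0
  obtain ⟨a1, b1, c1, d1, e1⟩ := hv 1
  obtain ⟨a2, b2, c2, d2, e2⟩ := hv 2
  obtain ⟨a3, b3, c3, d3, e3⟩ := hv 3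
  unfold projSq
  generalize waste q a s 0 = v0 at *
  generalize waste q a s 1 = v1 at *
  generalize waste q a s 2 = v2 at *
  generalize waste q a s 3 = v3 at *
  generalize imbalance (next q a s) = z
  set W := v0 + v1 + v2 + v3 with hWdef
  set y := v0 - v1 - v2 + v3 with hy
  have hyW : |y| ≤ W := abs_le.2 ⟨by linarith, by linarith⟩
  have hW4 : W ^ 2 ≤ 4 * W := by nlinarith
  have hy2 : y ^ 2 ≤ 4 * W := (sq_le_sq' (abs_le.1 hyW).1 (abs_le.1 hyW).2).trans hW4
  have hyoung : |z * y / 2| ≤ t⁻¹ * W + t / 4 * z ^ 2 := by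
    have ht' : 0 < t⁻¹ := inv_pos.2 ht
    have h1 : t⁻¹ * y ^ 2 ≤ t⁻¹ * (4 * W) := by gcongr
    have h2 : 0 ≤ t⁻¹ * (y - t * z) ^ 2 := by positivity
    have h3 : 0 ≤ t⁻¹ * (y + t * z) ^ 2 := by positivity
    have h4 : t⁻¹ * (y - t * z) ^ 2 = t⁻¹ * y ^ 2 - 2 * (z * y) + t * z ^ 2 := by
      field_simp; ring
    have h5 : t⁻¹ * (y + t * z) ^ 2 = t⁻¹ * y ^ 2 + 2 * (z * y) + t * z ^ 2 := by
      field_simp; ring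
    rw [abs_le]
    constructor <;> linarith
  rw [c0, c1, c2, c3]
  obtain ⟨k1, k2⟩ := abs_le.1 hyoung
  have hAW : (Amax : ℝ) * W = Amax * v0 + Amax * v1 + Amax * v2 + Amax * v3 := by
    rw [hWdef]; ring
  rw [abs_le]
  constructor
  · have := sq_nonneg y
    linarith
  · linarith

/-! ### The stationary drift identity and its error -/

section Moments

variable {A : PMF Vec} {p : MaxWeightPolicy} {π : PMF Vec} {Amax : ℕ} {ν : Fin 4 → ℝ} {ε : ℝ}

theorem integrable_of_le_total (hT : Integrable (fun q => total q ^ 3) π.toMeasure)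
    {F : Vec → ℝ} {C : ℝ} (hF : ∀ q, |F q| ≤ C * (1 + total q ^ 3)) :
    Integrable F π.toMeasure :=
  (((integrable_const (1 : ℝ)).add hT).const_mul C).mono'
    Measurable.of_discrete.aestronglyMeasurable (Eventually.of_forall hF)

theorem total_sq_le_one_add_cube (q : Vec) : total q ^ 2 ≤ 1 + total q ^ 3 := by
  have h4 := total_nonneg q
  nlinarith [sq_nonneg (total q - 1), mul_nonneg h4 (sq_nonneg (total q - 1))]

theorem abs_imbalance_le (q : Vec) : |imbalance q| ≤ total q := by
  have h : ∀ j, (0 : ℝ) ≤ q j := fun j => Nat.cast_nonneg _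
  unfold imbalance total
  exact abs_le.2 ⟨by linarith [h 0, h 1, h 2, h 3], by linarith [h 0, h 1, h 2, h 3]⟩

theorem integrable_coord (hT : Integrable (fun q => total q ^ 3) π.toMeasure) (i : Fin 4) :
    Integrable (fun q : Vec => (q i : ℝ)) π.toMeasure :=
  integrable_of_le_total (C := 1) hT fun q => by
    rw [abs_of_nonneg (Nat.cast_nonneg _), one_mul]
    exact (le_total q i).trans (total_le_one_add_cube q)

theorem integrable_total (hT : Integrable (fun q => total q ^ 3) π.toMeasure) :
    Integrable total π.toMeasure :=
  (((integrable_coord hT 0).add (integrable_coord hT 1)).add (integrable_coord hT 2)).add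
    (integrable_coord hT 3)

theorem integrable_imbalance (hT : Integrable (fun q => total q ^ 3) π.toMeasure) :
    Integrable imbalance π.toMeasure :=
  (((integrable_coord hT 0).sub (integrable_coord hT 1)).sub (integrable_coord hT 2)).add
    (integrable_coord hT 3)

theorem integrable_imbalance_sq (hT : Integrable (fun q => total q ^ 3) π.toMeasure) :
    Integrable (fun q => imbalance q ^ 2) π.toMeasure :=
  integrable_of_le_total (C := 1) hT fun q => by
    rw [abs_of_nonneg (sq_nonneg _), one_mul]
    have := abs_le.1 (abs_imbalance_le q)
    exact (sq_le_sq' this.1 this.2).trans (total_sq_le_one_add_cube q)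

theorem integrable_projSq (hT : Integrable (fun q => total q ^ 3) π.toMeasure) :
    Integrable (fun q : Vec => projSq (fun i => q i)) π.toMeasure := by
  have hsq : ∀ i, Integrable (fun q : Vec => (q i : ℝ) ^ 2) π.toMeasure := fun i =>
    integrable_of_le_total (C := 1) hT fun q => by
      rw [abs_of_nonneg (sq_nonneg _), one_mul]
      exact (pow_le_pow_left₀ (Nat.cast_nonneg _) (le_total q i) 2).trans
        (total_sq_le_one_add_cube q)
  exact ((((hsq 0).add (hsq 1)).add (hsq 2)).add (hsq 3)).sub
    ((integrable_imbalance_sq hT).div_const 4)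

theorem integrable_projCoord (hT : Integrable (fun q => total q ^ 3) π.toMeasure) (j : Fin 4) :
    Integrable (fun q : Vec => projCoord (fun i => q i) j) π.toMeasure :=
  (integrable_coord hT j).sub (((integrable_imbalance hT).const_mul _).div_const 4)

/-- By independence the covariance matrix is diagonal, and every diagonal entry of the projection
matrix is 1 - 1/4 = 3/4. -/
theorem integral_arrival_projSq (hA : ∀ a ∈ A.support, ∀ i, a i ≤ Amax)
    (hind : iIndepFun (fun (i : Fin 4) (a : Vec) => a i) A.toMeasure)
    {m : Fin 4 → ℝ} (hm : ∀ i, ∫ a : Vec, (a i : ℝ) ∂A.toMeasure = m i) :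
    ∫ a : Vec, projSq (fun i => a i) ∂A.toMeasure
      = 3 / 4 * ∑ i, variance (fun a : Vec => (a i : ℝ)) A.toMeasure + projSq m := by
  let G : Fin 4 → Fin 4 → ℝ := fun i j => (if i = j then 1 else 0)
    - (![1, -1, -1, 1] : Fin 4 → ℝ) i * (![1, -1, -1, 1] : Fin 4 → ℝ) j / 4
  have hG : ∀ x : Fin 4 → ℝ, projSq x = ∑ i, ∑ j, G i j * (x i * x j) := by
    intro x
    simp [Fin.sum_univ_four, G, projSq]
    ring
  have hbd : ∀ i, ∀ a ∈ A.support, (a i : ℝ) ≤ Amax := fun i a ha => by exact_mod_cast hA a ha i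
  have hint : ∀ i j, Integrable (fun a : Vec => (a i : ℝ) * a j) A.toMeasure := fun i j =>
    integrable_of_bounded_support (C := Amax * Amax) fun a ha => by
      rw [abs_of_nonneg (by positivity)]
      exact mul_le_mul (hbd i a ha) (hbd j a ha) (Nat.cast_nonneg _) (Nat.cast_nonneg _)
  have hprod : ∀ i j, ∫ a : Vec, (a i : ℝ) * a j ∂A.toMeasure
      = m i * m j + if i = j then variance (fun a : Vec => (a i : ℝ)) A.toMeasure else 0 := by
    intro i j
    by_cases hij : i = j
    · subst hij
      have hLp : MemLp (fun a : Vec => (a i : ℝ)) 2 A.toMeasure := by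
        rw [memLp_two_iff_integrable_sq Measurable.of_discrete.aestronglyMeasurable]
        simpa only [sq] using hint i i
      rw [if_pos rfl, variance_eq_sub hLp, hm]
      simp only [Pi.pow_apply, sq]
      ring
    · have h1 : IndepFun (fun a : Vec => (a i : ℝ)) (fun a : Vec => (a j : ℝ)) A.toMeasure :=
        (hind.indepFun hij).comp (φ := fun k : ℕ => (k : ℝ)) (ψ := fun k : ℕ => (k : ℝ))
          Measurable.of_discrete Measurable.of_discrete
      rw [if_neg hij, add_zero, h1.integral_fun_mul_eq_mul_integral
        Measurable.of_discrete.aestronglyMeasurable Measurable.of_discrete.aestronglyMeasurable,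
        hm, hm]
  simp only [hG]
  rw [integral_finsetSum _ fun i _ => integrable_finsetSum _ fun j _ => (hint i j).const_mul _]
  simp only [integral_finsetSum _ fun j _ => (hint _ j).const_mul _, integral_const_mul, hprod]
  simp [Fin.sum_univ_four, G]
  ring

theorem integrable_arrival_projSq (hA : ∀ a ∈ A.support, ∀ i, a i ≤ Amax) :
    Integrable (fun a : Vec => projSq (fun i => a i)) A.toMeasure := by
  have hfin : {a : Vec | ∀ i, a i ≤ Amax}.Finite := Set.finite_Iic (fun _ : Fin 4 => Amax)
  obtain ⟨C, hC⟩ := (hfin.image fun a => |projSq (fun i => a i)|).bddAbove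
  exact integrable_of_bounded_support (C := C) fun a ha => hC (mem_image_of_mem _ (hA a ha))

/-- The scaled mean total queue length in steady state, up to the effect of wasted service. -/
theorem abs_total_sub_le (hA : ∀ a ∈ A.support, ∀ i, a i ≤ Amax)
    (hind : iIndepFun (fun (i : Fin 4) (a : Vec) => a i) A.toMeasure)
    (h01 : ν 0 + ν 1 = 1) (h2 : ν 2 = ν 1) (h3 : ν 3 = ν 0)
    (hm : ∀ i, ∫ a : Vec, (a i : ℝ) ∂A.toMeasure = (1 - ε) * ν i)
    (hπ : IsSteadyState A p π) (hT : Integrable (fun q => total q ^ 3) π.toMeasure)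
    {t : ℝ} (ht : 0 < t) :
    |ε * ∫ q, total q ∂π.toMeasure
        - 3 / 4 * ∑ i, variance (fun a : Vec => (a i : ℝ)) A.toMeasure - ε ^ 2|
      ≤ (2 * Amax + 1 + t⁻¹) * (2 * ε) + t / 4 * ∫ q, imbalance q ^ 2 ∂π.toMeasure := by
  let μ := slotLaw A p π
  have hq := measurePreserving_queue (A := A) (p := p) (π := π)
  have ha := measurePreserving_arrivals (A := A) (p := p) (π := π)
  have hn := measurePreserving_next hπ
  have int_map : ∀ {X : (Vec × Vec) × Vec → Vec} {ρ : PMF Vec},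
      MeasurePreserving X μ ρ.toMeasure → ∀ F : Vec → ℝ,
        ∫ ω, F (X ω) ∂μ = ∫ x, F x ∂ρ.toMeasure := by
    intro X ρ hX F
    rw [← hX.map_eq, integral_map hX.measurable.aemeasurable
      Measurable.of_discrete.aestronglyMeasurable]
  have hTi := integrable_total hT
  have hTa : Integrable total A.toMeasure :=
    (((integrable_arrival hA 0).add (integrable_arrival hA 1)).add (integrable_arrival hA 2)).add
      (integrable_arrival hA 3)
  have hTam : ∫ a, total a ∂A.toMeasure = 2 * (1 - ε) := by
    have i0 := integrable_arrival hA 0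
    have i1 := integrable_arrival hA 1
    have i2 := integrable_arrival hA 2
    have i3 := integrable_arrival hA 3
    unfold total
    rw [integral_add ((i0.fun_add i1).fun_add i2) i3, integral_add (i0.fun_add i1) i2,
      integral_add i0 i1,
      hm, hm, hm, hm, h2, h3]
    linear_combination 2 * (1 - ε) * h01
  -- the mean wasted service
  have hW : Integrable totalWaste μ ∧ ∫ ω, totalWaste ω ∂μ = 2 * ε := by
    have i1 : Integrable (fun ω : (Vec × Vec) × Vec => total (next ω.1.1 ω.2 ω.1.2)) μ :=
      hn.integrable_comp_of_integrable hTi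
    have i2 : Integrable (fun ω : (Vec × Vec) × Vec => total ω.1.1) μ :=
      hq.integrable_comp_of_integrable hTi
    have i3 : Integrable (fun ω : (Vec × Vec) × Vec => total ω.2) μ :=
      ha.integrable_comp_of_integrable hTa
    refine ⟨((i1.sub i2).sub i3).add (integrable_const _), ?_⟩
    unfold totalWaste
    rw [integral_add ((i1.sub' i2).sub' i3) (integrable_const _), integral_sub (i1.sub' i2) i3,
      integral_sub i1 i2, int_map hn, int_map hq, int_map ha, hTam]
    simp
    ring
  have hZ : Integrable (fun ω : (Vec × Vec) × Vec => imbalance (next ω.1.1 ω.2 ω.1.2) ^ 2) μ :=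
    hn.integrable_comp_of_integrable (integrable_imbalance_sq hT)
  have hZm := int_map hn fun q => imbalance q ^ 2
  -- the mean effect of the wasted service
  have hR : ∫ ω, wasteTerm ω ∂μ = ε * ∫ q, total q ∂π.toMeasure
      - 3 / 4 * ∑ i, variance (fun a : Vec => (a i : ℝ)) A.toMeasure - ε ^ 2 := by
    have i1 : Integrable (fun ω : (Vec × Vec) × Vec =>
        projSq (fun i => next ω.1.1 ω.2 ω.1.2 i)) μ :=
      hn.integrable_comp_of_integrable (integrable_projSq hT)
    have i2 : Integrable (fun ω : (Vec × Vec) × Vec => projSq (fun i => ω.1.1 i)) μ :=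
      hq.integrable_comp_of_integrable (integrable_projSq hT)
    have i3 : ∀ j, Integrable (fun ω : (Vec × Vec) × Vec =>
        projCoord (fun i => ω.1.1 i) j * ω.2 j) μ := fun j =>
      Integrable.mul_prod (f := fun x : Vec × Vec => projCoord (fun i => x.1 i) j)
        (g := fun a : Vec => (a j : ℝ))
        (by
          have h : Integrable (fun ω : (Vec × Vec) × Vec => projCoord (fun i => ω.1.1 i) j) μ :=
            hq.integrable_comp_of_integrable (integrable_projCoord hT j)
          exact ((measurePreserving_fst (ν := A.toMeasure)).integrable_comp
            Measurable.of_discrete.aestronglyMeasurable).1 h)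
        (integrable_arrival hA j)
    have i3' : Integrable (fun ω : (Vec × Vec) × Vec =>
        ∑ j, projCoord (fun i => ω.1.1 i) j * ω.2 j) μ := integrable_finsetSum _ fun j _ => i3 j
    have i4 : Integrable (fun ω : (Vec × Vec) × Vec => total ω.1.1) μ :=
      hq.integrable_comp_of_integrable hTi
    have i5 : Integrable (fun a : Vec => projSq (fun i => a i) - total a + 1) A.toMeasure :=
      ((integrable_arrival_projSq hA).sub hTa).add (integrable_const _)
    have i5' : Integrable (fun ω : (Vec × Vec) × Vec =>
        projSq (fun i => ω.2 i) - total ω.2 + 1) μ := ha.integrable_comp_of_integrable i5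
    have m3 : ∀ j, ∫ ω : (Vec × Vec) × Vec, projCoord (fun i => ω.1.1 i) j * ω.2 j ∂μ
        = (∫ q : Vec, projCoord (fun i => q i) j ∂π.toMeasure) * ((1 - ε) * ν j) := by
      intro j
      rw [← hm j, ← int_map hq]
      have h1 := integral_prod_mul
        (μ := (π.bind fun q => (p.sched q).map fun s => (q, s)).toMeasure) (ν := A.toMeasure)
        (fun x : Vec × Vec => projCoord (fun i => x.1 i) j) (fun a : Vec => (a j : ℝ))
      have h2 := integral_prod_mul
        (μ := (π.bind fun q => (p.sched q).map fun s => (q, s)).toMeasure) (ν := A.toMeasure)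
        (fun x : Vec × Vec => projCoord (fun i => x.1 i) j) (fun _ : Vec => (1 : ℝ))
      simp only [mul_one, integral_const, probReal_univ, smul_eq_mul] at h2
      change ∫ ω, _ ∂((PMF.toMeasure _).prod _) = (∫ ω, _ ∂((PMF.toMeasure _).prod _)) * _
      rw [h2]
      exact h1
    have m3' : ∫ ω : (Vec × Vec) × Vec, ∑ j, projCoord (fun i => ω.1.1 i) j * ω.2 j ∂μ
        = (1 - ε) / 2 * ∫ q, total q ∂π.toMeasure := by
      rw [integral_finsetSum _ fun j _ => i3 j]
      simp only [m3, ← integral_mul_const]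
      rw [← integral_finsetSum _ fun j _ => (integrable_projCoord hT j).mul_const _,
        ← integral_const_mul]
      congr 1
      ext q
      simp [Fin.sum_univ_four, projCoord, total, h2, h3]
      have e1 : ν 1 = 1 - ν 0 := by linarith
      rw [e1]
      ring
    have m5 : ∫ ω : (Vec × Vec) × Vec, (projSq (fun i => ω.2 i) - total ω.2 + 1) ∂μ
        = 3 / 4 * ∑ i, variance (fun a : Vec => (a i : ℝ)) A.toMeasure + ε ^ 2 := by
      rw [int_map ha fun a => projSq (fun i => a i) - total a + 1,
        integral_add ((integrable_arrival_projSq hA).sub' hTa) (integrable_const _),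
        integral_sub (integrable_arrival_projSq hA) hTa, hTam,
        integral_arrival_projSq hA hind hm]
      simp [projSq, h2, h3]
      have e1 : ν 1 = 1 - ν 0 := by linarith
      rw [e1]
      ring
    unfold wasteTerm
    rw [integral_sub (((i1.sub' i2).sub' (i3'.const_mul 2)).fun_add i4) i5',
      integral_add ((i1.sub' i2).sub' (i3'.const_mul 2)) i4,
      integral_sub (i1.sub' i2) (i3'.const_mul 2), integral_sub i1 i2, integral_const_mul, m3', m5,
      int_map hn fun q => projSq (fun i => q i), int_map hq fun q => projSq (fun i => q i),
      int_map hq]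
    ring
  rw [← hR]
  have hbound : ∀ᵐ ω ∂μ, ‖wasteTerm ω‖ ≤ (2 * Amax + 1 + t⁻¹) * totalWaste ω
      + t / 4 * imbalance (next ω.1.1 ω.2 ω.1.2) ^ 2 :=
    ae_slotLaw.mono fun ω hω => abs_wasteTerm_le hω.1 (hA _ hω.2) ht
  refine (norm_integral_le_of_norm_le ((hW.1.const_mul _).fun_add (hZ.const_mul _))
    hbound).trans_eq ?_
  rw [integral_add (hW.1.const_mul _) (hZ.const_mul _), integral_const_mul, integral_const_mul,
    hW.2, hZm]

/-- The distance of `ε E[q₁ + q₂]` from its limit, in terms of the second moment of the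
imbalance. -/
theorem abs_cross_sub_le (hA : ∀ a ∈ A.support, ∀ i, a i ≤ Amax)
    (hind : iIndepFun (fun (i : Fin 4) (a : Vec) => a i) A.toMeasure)
    (h01 : ν 0 + ν 1 = 1) (h2 : ν 2 = ν 1) (h3 : ν 3 = ν 0) (hε : 0 < ε)
    (hm : ∀ i, ∫ a : Vec, (a i : ℝ) ∂A.toMeasure = (1 - ε) * ν i)
    (hπ : IsSteadyState A p π) (hT : Integrable (fun q => total q ^ 3) π.toMeasure) {K : ℝ}
    (hK : ∫ q, imbalance q ^ 2 ∂π.toMeasure ≤ K) :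
    |ε * ∫ q : Vec, ((q 1 : ℝ) + (q 2 : ℝ)) ∂π.toMeasure
        - 3 / 8 * ∑ i, variance (fun a : Vec => (a i : ℝ)) A.toMeasure|
      ≤ ε ^ 2 + (2 * Amax + 1) * ε + √ε * (1 + K) + ε * (1 + K) := by
  -- The choice t = √ε makes both t⁻¹ε and t of order √ε.
  have h := abs_total_sub_le hA hind h01 h2 h3 hm hπ hT (Real.sqrt_pos.2 hε)
  have hz2 : 0 ≤ ∫ q, imbalance q ^ 2 ∂π.toMeasure := integral_nonneg fun q => sq_nonneg _
  have hz : |∫ q, imbalance q ∂π.toMeasure| ≤ 1 + K := by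
    refine (norm_integral_le_of_norm_le (f := imbalance) ((integrable_const (1 : ℝ)).fun_add
      (integrable_imbalance_sq hT)) (Eventually.of_forall fun q => ?_)).trans ?_
    · rw [Real.norm_eq_abs]
      rw [← sq_abs]
      nlinarith [sq_nonneg (|imbalance q| - 1), abs_nonneg (imbalance q)]
    · rw [integral_add (integrable_const _) (integrable_imbalance_sq hT)]
      simpa using hK
  have he : ∫ q : Vec, ((q 1 : ℝ) + (q 2 : ℝ)) ∂π.toMeasure
      = (∫ q, total q ∂π.toMeasure - ∫ q, imbalance q ∂π.toMeasure) / 2 := by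
    rw [← integral_sub (integrable_total hT) (integrable_imbalance hT), ← integral_div]
    congr 1
    ext q
    unfold total imbalance
    ring
  have hs : (√ε)⁻¹ * ε = √ε := by
    have := Real.sqrt_pos.2 hε
    field_simp
    exact (Real.sq_sqrt hε.le).symm
  have hsz := mul_le_mul_of_nonneg_left hK (Real.sqrt_nonneg ε)
  have hK0 : 0 ≤ K := hz2.trans hK
  have hsK := mul_nonneg (Real.sqrt_nonneg ε) hK0
  have hεz : |ε * ∫ q, imbalance q ∂π.toMeasure| ≤ ε * (1 + K) := by
    rw [abs_mul, abs_of_pos hε]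
    gcongr
  rw [he]
  have hε2 := sq_nonneg ε
  obtain ⟨k1, k2⟩ := abs_le.1 h
  obtain ⟨l1, l2⟩ := abs_le.1 hεz
  have hexp : (2 * (Amax : ℝ) + 1 + (√ε)⁻¹) * (2 * ε) = 2 * ((2 * Amax + 1) * ε) + 2 * √ε := by
    linear_combination 2 * hs
  rw [hexp] at k1 k2
  have hAε : 0 ≤ (2 * (Amax : ℝ) + 1) * ε := by positivity
  rw [abs_le]
  constructor <;> linarith

end Moments

end InputQueuedSwitch

/-! ### Heavy traffic limit -/

theorem corollary7
    (ν : Fin 4 → ℝ) (hν_pos : ∀ i, 0 < ν i)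
    (hν_row₁ : ν 0 + ν 1 = 1) (hν_row₂ : ν 2 + ν 3 = 1)
    (hν_col₁ : ν 0 + ν 2 = 1) (hν_col₂ : ν 1 + ν 3 = 1)
    (A : ℝ → PMF Vec) (p : ℝ → MaxWeightPolicy) (Amax : ℕ)
    (hA_bdd : ∀ ε ∈ Ioo (0 : ℝ) 1, ∀ a ∈ (A ε).support, ∀ i, a i ≤ Amax)
    (hA_indep : ∀ ε ∈ Ioo (0 : ℝ) 1,
      iIndepFun (fun (i : Fin 4) (a : Vec) => a i) (A ε).toMeasure)
    (hA_mean : ∀ ε ∈ Ioo (0 : ℝ) 1, ∀ i,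
      ∫ a : Vec, (a i : ℝ) ∂(A ε).toMeasure = (1 - ε) * ν i)
    (σ : Fin 4 → ℝ)
    (hA_var : ∀ i, Tendsto
      (fun ε : ℝ => variance (fun a : Vec => (a i : ℝ)) (A ε).toMeasure)
      (𝓝[>] 0) (𝓝 (σ i ^ 2))) :
    (∀ ε ∈ Ioo (0 : ℝ) 1, ∃! π : PMF Vec, IsSteadyState (A ε) (p ε) π) ∧
    ∀ π : ℝ → PMF Vec, (∀ ε ∈ Ioo (0 : ℝ) 1, IsSteadyState (A ε) (p ε) (π ε)) →
      (∀ ε ∈ Ioo (0 : ℝ) 1,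
        Integrable (fun q : Vec => (q 1 : ℝ) + (q 2 : ℝ)) (π ε).toMeasure) ∧
      Tendsto (fun ε : ℝ => ε * ∫ q : Vec, ((q 1 : ℝ) + (q 2 : ℝ)) ∂(π ε).toMeasure)
        (𝓝[>] 0)
        (𝓝 (3 / 8 * (σ 0 ^ 2 + σ 1 ^ 2 + σ 2 ^ 2 + σ 3 ^ 2))) := by
  have h2 : ν 2 = ν 1 := by linarith
  have h3 : ν 3 = ν 0 := by linarith
  have hmin : 0 < min (ν 0) (ν 1) := lt_min (hν_pos 0) (hν_pos 1)
  have hdrift := fun ε (hε : ε ∈ Ioo (0 : ℝ) 1) => total_drift (p ε) (hA_bdd ε hε) (hν_pos 0)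
    (hν_pos 1) hν_row₁ h2 h3 hε.1 (hA_mean ε hε)
  have hconst : ∀ c, 0 ≤ driftConst Amax c 4 := fun c => by unfold driftConst; positivity
  refine ⟨fun ε hε => ?_, fun π hπ => ?_⟩
  · have hc : 0 < 2 * (ε * min (ν 0) (ν 1)) / 4 := by have := hε.1; positivity
    obtain ⟨π, hπ⟩ := exists_stationary_of_drift (α := Vec)
      (V := fun q => ENNReal.ofReal ((∑ i, (q i : ℝ) ^ 2) ^ 2)) 0 ENNReal.ofReal_ne_top
      ENNReal.ofReal_ne_top
      (hdrift ε hε) (finite_total_sublevel hc)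
    have hzero : A ε 0 ≠ 0 := by
      refine apply_zero_ne_zero (hA_bdd ε hε) (hA_indep ε hε) fun i => ?_
      rw [hA_mean ε hε]
      have hν1 : ν i < 1 := by
        have k0 := hν_pos 0
        have k1 := hν_pos 1
        fin_cases i <;> simp <;> linarith
      nlinarith [hν_pos i, hε.1, hε.2]
    exact ⟨π, hπ, fun π' hπ' => stationary_unique (eq_zero_of_invariant hzero) hπ' hπ⟩
  have hT : ∀ ε ∈ Ioo (0 : ℝ) 1, Integrable (fun q => total q ^ 3) (π ε).toMeasure := by
    intro ε hε
    have hc : 0 < 2 * (ε * min (ν 0) (ν 1)) / 4 := by have := hε.1; positivity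
    exact (integrable_of_tsum_le hc (hconst _) (fun q => pow_nonneg (total_nonneg q) 3)
      (tsum_mul_le_of_drift (hπ ε hε) (fun _ => ENNReal.ofReal_ne_top) (hdrift ε hε))).1
  refine ⟨fun ε hε => (integrable_coord (hT ε hε) 1).add (integrable_coord (hT ε hε) 2), ?_⟩
  have hc : 0 < 2 * (min (ν 0) (ν 1) / 2) / 4 := by positivity
  -- This bounds the second moment of the imbalance through x² ≤ 1 + |x|³; it does not depend on ε.
  set K : ℝ := 1 + driftConst Amax (min (ν 0) (ν 1) / 2) 4 / (2 * (min (ν 0) (ν 1) / 2) / 4)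
    with hKdef
  have hnear : ∀ᶠ ε in 𝓝[>] (0 : ℝ), ε ∈ Ioo (0 : ℝ) 1 ∧ ε ≤ min (ν 0) (ν 1) / 4 := by
    filter_upwards [Ioo_mem_nhdsGT (zero_lt_one (α := ℝ)),
      Ioo_mem_nhdsGT (show 0 < min (ν 0) (ν 1) / 4 by positivity)] with ε h h'
    exact ⟨h, h'.2.le⟩
  have hK : ∀ ε ∈ Ioo (0 : ℝ) 1, ε ≤ min (ν 0) (ν 1) / 4 →
      ∫ q, imbalance q ^ 2 ∂(π ε).toMeasure ≤ K := by
    intro ε hε hε'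
    obtain ⟨i1, i2⟩ := integrable_of_tsum_le hc (hconst _)
      (fun q => pow_nonneg (abs_nonneg (imbalance q)) 3)
      (tsum_mul_le_of_drift (hπ ε hε) (fun _ => ENNReal.ofReal_ne_top)
        (imbalance_drift (p ε) (hA_bdd ε hε) (hν_pos 0) (hν_pos 1) hν_row₁ h2 h3 hε.1 hε'
          (hA_mean ε hε)))
    calc ∫ q, imbalance q ^ 2 ∂(π ε).toMeasure
        ≤ ∫ q, (1 + |imbalance q| ^ 3) ∂(π ε).toMeasure := by
          refine integral_mono (integrable_imbalance_sq (hT ε hε))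
            ((integrable_const _).fun_add i1) fun q => ?_
          change imbalance q ^ 2 ≤ 1 + |imbalance q| ^ 3
          rw [← sq_abs]
          have := abs_nonneg (imbalance q)
          nlinarith [sq_nonneg (|imbalance q| - 1),
            mul_nonneg this (sq_nonneg (|imbalance q| - 1))]
      _ ≤ K := by
          rw [integral_add (integrable_const _) i1, hKdef]
          simpa using i2
  have hvar : Tendsto (fun ε => 3 / 8 * ∑ i, variance (fun a : Vec => (a i : ℝ)) (A ε).toMeasure)
      (𝓝[>] 0) (𝓝 (3 / 8 * (σ 0 ^ 2 + σ 1 ^ 2 + σ 2 ^ 2 + σ 3 ^ 2))) := by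
    simp only [Fin.sum_univ_four]
    exact ((((hA_var 0).add (hA_var 1)).add (hA_var 2)).add (hA_var 3)).const_mul _
  have herr : Tendsto (fun ε : ℝ => ε ^ 2 + (2 * Amax + 1) * ε + √ε * (1 + K) + ε * (1 + K))
      (𝓝[>] 0) (𝓝 0) := by
    have hcont : Continuous fun ε : ℝ =>
        ε ^ 2 + (2 * Amax + 1) * ε + √ε * (1 + K) + ε * (1 + K) := by fun_prop
    have := hcont.tendsto 0
    simp only [Real.sqrt_zero] at this
    refine Tendsto.mono_left ?_ nhdsWithin_le_nhds
    simpa using this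
  have hdiff : Tendsto (fun ε : ℝ => ε * ∫ q : Vec, ((q 1 : ℝ) + (q 2 : ℝ)) ∂(π ε).toMeasure
      - 3 / 8 * ∑ i, variance (fun a : Vec => (a i : ℝ)) (A ε).toMeasure) (𝓝[>] 0) (𝓝 0) :=
    squeeze_zero_norm' (hnear.mono fun ε h => abs_cross_sub_le (hA_bdd ε h.1)
    (hA_indep ε h.1) hν_row₁ h2 h3 h.1.1 (hA_mean ε h.1) (hπ ε h.1) (hT ε h.1) (hK ε h.1 h.2)) herr
  simpa using hdiff.add hvar
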